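/- **Setting.** For every $n\in\mathbb N$ let $(w_x^+)_{x\in[n]}$ and $(w_x^-)_{x\in[n]}$ be positive weights (which may depend on $n$) with $\sum_{x}w_x^+=\sum_x w_x^-=:\mathbf w$. Assume that there are constants $M_0,M_1>1$, $M_2>0$ and $0<\eta<1$, independent of $n$, such that for every $n$ $$M_0\le w_x^+\le M_1\quad\text{for all }x\in[n],\qquad \sum_{x\in[n]}(w_x^-)^{2+\eta}\le M_2\,n .$$ Let $G$ be the Chung–Lu digraph on $[n]$: for distinct $x,y$ the edge $x\to y$ is present independently with probability $p_{xy}=\left(w_x^+w_y^-\frac{\log n}{n}\right)\wedge 1$, and there are no loops; let $\mathbb P$ be its law. Let $D_x^+$ be the out-degree of $x$, and let $P(x,y)=1/D_x^+$ if $x\to y$ and $P(x,y)=0$ otherwise. The mass of a path $\mathfrak p=(x_0,\dots,x_k)$ is $\mathbf m(\mathfrak p)=\prod_{i<k}P(x_i,x_{i+1})$. Set $$H=\sum_{x\in[n]}\frac{w_x^-}{\mathbf w}\,\mathbb E\big[\log(D_x^+\vee 1)\big],\qquad t_{\rm ent}=\frac{\log n}{H},\qquad h_\varepsilon=\Big\lfloor\frac{\varepsilon\log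 n}{20H}\Big\rfloor .$$ *$h_\varepsilon$-roots.* For $h\in\mathbb N$, $\mathcal B_x^+(h)$ is the subgraph of $G$ formed by the vertices and edges of the oriented paths of length at most $h$ starting at $x$. Let $V_\varepsilon$ be the set of $x\in[n]$ such that $\mathcal B_x^+(h_\varepsilon)$ is a directed tree rooted at $x$ (each of its vertices is reached from $x$ by exactly one oriented path in it). *The tree $\mathcal T_x(s)$.* Fix $\gamma\in(0,1)$, $s\in\mathbb N$ and $x\in[n]$. Start with $\mathcal G^0=\mathcal T^0=\{x\}$. At step $\ell\ge1$, consider the edges $e$ of $G$ whose tail $v$ is a vertex of $\mathcal G^{\ell-1}$, which have not been visited in an earlier step, and such that the unique path $\mathfrak p_{x,v}$ from $x$ to $v$ in $\mathcal T^{\ell-1}$ has length at most $s-1$; put $\hat{\mathbf m}(e)=\mathbf m(\mathfrak p_{x,v})/D_v^+$. Choose among these edges one, $e_\ell$, of maximal $\hat{\mathbf m}$ (ties broken arbitrarily), provided that $\hat{\mathbf m}(e_\ell)\ge e^{-(1+\gamma)Hs}$; if there is no such edge, stop. Let $\mathcal G^\ell=\mathcal G^{\ell-1}\cup\{e_\ell\}$;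 let $\mathcal T^\ell=\mathcal T^{\ell-1}\cup\{e_\ell\}$ if the head of $e_\ell$ is not a vertex of $\mathcal G^{\ell-1}$, and $\mathcal T^\ell=\mathcal T^{\ell-1}$ otherwise. $\mathcal T_x(s)$ is the tree obtained when the procedure stops. **Proposition 5.2.** For all $\varepsilon,\gamma\in(0,1)$, every sequence of integers $s=s(n)\ge 0$ with $s\le(1-\gamma)t_{\rm ent}$ for all large $n$, and every way of breaking ties in the procedure above, $$\min_{x\in V_\varepsilon}\Bigg(\sum_{y\in[n]}\ \sum_{\mathfrak p\in\mathcal P(x,y,s,\mathcal T_x(s))}\mathbf m(\mathfrak p)\Bigg)\ \longrightarrow\ 1\qquad\text{in }\mathbb P\text{-probability as }n\to\infty,$$ where $\mathcal P(x,y,s,\mathcal T_x(s))$ is the set of paths of length $s$ from $x$ to $y$ all of whose edges belong to $\mathcal T_x(s)$. In particular the minimum is well defined, i.e. $V_\varepsilon\ne\emptyset$, with probability tending to $1$. -/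

import Mathlib

open MeasureTheory ProbabilityTheory Filter Topology
open scoped ENNReal

noncomputable section

namespace ChungLu

/-! ### Directed graphs, paths and the simple random walk -/

section Graph

variable {V : Type*}

/-- The set of (oriented) edges of a digraph, an edge `(a, b)` having tail `a` and head `b`. -/
def edges (G : Digraph V) : Set (V × V) := {e | G.Adj e.1 e.2}

/-- The out-degree `D_x^+`. -/
def outDegree (G : Digraph V) (x : V) : ℕ := Set.ncard {y | G.Adj x y}

open Classical in
/-- Transition matrix of the simple random walk: `P(x, y) = 1 / D_x^+` if `x → y`, else `0`. -/
def stepProb (G : Digraph V) (x y : V) : ℝ :=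
  if G.Adj x y then 1 / (outDegree G x : ℝ) else 0

/-- `p = (p 0, …, p k)` is an oriented path of length `k` from `x` to `y` all of whose edges belong
to `E` (vertices may be repeated). -/
def IsPath (E : Set (V × V)) (x y : V) {k : ℕ} (p : Fin (k + 1) → V) : Prop :=
  p 0 = x ∧ p (Fin.last k) = y ∧ ∀ i : Fin k, (p i.castSucc, p i.succ) ∈ E

/-- The mass `m(p) = ∏_{i < k} P(p i, p (i+1))` of a path of length `k`. -/
def pathMass (G : Digraph V) {k : ℕ} (p : Fin (k + 1) → V) : ℝ :=
  ∏ i : Fin k, stepProb G (p i.castSucc) (p i.succ)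

open Classical in
/-- `∑_y ∑_p m(p)`, where `p` runs over the paths of length `s` from `x` to `y` using only edges
in `E`. -/
def totalPathMass [Fintype V] (G : Digraph V) (E : Set (V × V)) (x : V) (s : ℕ) : ℝ :=
  ∑ y : V, ∑ p ∈ (Finset.univ : Finset (Fin (s + 1) → V)).filter (fun p => IsPath E x y p),
    pathMass G p

/-- The graph with vertex set `W` and edge set `E` is a directed tree rooted at `x`: every vertex
is reached from `x` by exactly one oriented path. -/
def IsDirectedTree (x : V) (W : Set V) (E : Set (V × V)) : Prop :=
  x ∈ W ∧ (∀ e ∈ E, e.1 ∈ W ∧ e.2 ∈ W) ∧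
    ∀ v ∈ W, ∃! q : (k : ℕ) × (Fin (k + 1) → V), IsPath E x v q.2

/-- Vertices of the out-neighbourhood of `x` of radius `h`: endpoints of oriented paths of length
at most `h` starting at `x`. -/
def outBall (G : Digraph V) (x : V) (h : ℕ) : Set V :=
  {y | ∃ k ≤ h, ∃ p : Fin (k + 1) → V, IsPath (edges G) x y p}

/-- Edges of the out-neighbourhood of `x` of radius `h`: the edges traversed by the oriented paths
of length at most `h` starting at `x`, i.e. the edges whose tail is reached in fewer than `h`
steps. -/
def outBallEdges (G : Digraph V) (x : V) (h : ℕ) : Set (V × V) :=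
  {e | e ∈ edges G ∧ ∃ k < h, ∃ p : Fin (k + 1) → V, IsPath (edges G) x e.1 p}

/-- The set of `h`-roots: vertices whose out-neighbourhood of radius `h` is a directed tree. -/
def treeRoots (G : Digraph V) (h : ℕ) : Set V :=
  {x | IsDirectedTree x (outBall G x h) (outBallEdges G x h)}

/-! ### The greedy mass-exploration algorithm

A state of the algorithm started at `x` consists of the set `E` of edges explored so far (the edges
of `𝒢^ℓ`) and the subset `T ⊆ E` of edges of its spanning tree `𝒯^ℓ`. -/

/-- Vertex set of the subgraph with root `x` and edge set `E`. -/
def verts (x : V) (E : Set (V × V)) : Set V :=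
  {v | v = x ∨ ∃ e ∈ E, v = e.1 ∨ v = e.2}

/-- The edges of `G` with tail in the explored subgraph that have not been visited yet. -/
def frontier (G : Digraph V) (x : V) (E : Set (V × V)) : Set (V × V) :=
  {e | e ∈ edges G ∧ e.1 ∈ verts x E ∧ e ∉ E}

/-- The path of `T` from `x` to the tail `v` of `e` has length `d` (the distance of `v` from the
root in the tree), and `m = m(path) · 1 / D_v^+` is the cumulative mass of `e`.
The path is unique, see `Exploration.isDirectedTree`. -/
def HasCumulativeMass (G : Digraph V) (x : V) (T : Set (V × V)) (e : V × V) (d : ℕ) (m : ℝ) :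
    Prop :=
  ∃ p : Fin (d + 1) → V, IsPath T x e.1 p ∧ m = pathMass G p * (1 / (outDegree G e.1 : ℝ))

/-- `e` may be chosen next: its tail is at distance at most `s - 1` from the root, its cumulative
mass is at least `θ`, and it is maximal among all unvisited edges whose tail is a vertex of the
explored subgraph at distance at most `s - 1` from the root. -/
def IsChoice (G : Digraph V) (x : V) (s : ℕ) (θ : ℝ) (E T : Set (V × V)) (e : V × V) : Prop :=
  e ∈ frontier G x E ∧
    ∃ d m, HasCumulativeMass G x T e d m ∧ d + 1 ≤ s ∧ θ ≤ m ∧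
      ∀ e' ∈ frontier G x E, ∀ d' m', HasCumulativeMass G x T e' d' m' → d' + 1 ≤ s → m' ≤ m

/-- `Exploration G x s θ E T`: the state `(E, T)` can be reached by the algorithm started at `x`
(ties between edges of maximal cumulative mass may be broken in any way). -/
inductive Exploration (G : Digraph V) (x : V) (s : ℕ) (θ : ℝ) :
    Set (V × V) → Set (V × V) → Prop
  | init : Exploration G x s θ ∅ ∅
  | keep {E T : Set (V × V)} {e : V × V} (hrun : Exploration G x s θ E T)
      (he : IsChoice G x s θ E T e) (hnew : e.2 ∉ verts x E) :
      Exploration G x s θ (insert e E) (insert e T)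
  | discard {E T : Set (V × V)} {e : V × V} (hrun : Exploration G x s θ E T)
      (he : IsChoice G x s θ E T e) (hold : e.2 ∈ verts x E) :
      Exploration G x s θ (insert e E) T

/-- `T` is (the edge set of) a tree produced by the algorithm started at `x` with depth parameter
`s` and mass threshold `θ`, run until no edge can be chosen any more. -/
def IsGreedyTree (G : Digraph V) (x : V) (s : ℕ) (θ : ℝ) (T : Set (V × V)) : Prop :=
  ∃ E, Exploration G x s θ E T ∧ ¬ ∃ e, IsChoice G x s θ E T e

theorem root_mem_verts (x : V) (E : Set (V × V)) : x ∈ verts x E := Or.inl rfl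

theorem verts_insert_of_mem {x : V} {E : Set (V × V)} {e : V × V} (h1 : e.1 ∈ verts x E)
    (h2 : e.2 ∈ verts x E) : verts x (insert e E) = verts x E := by
  ext v
  constructor
  · rintro (h | ⟨f, hf, hv⟩)
    · exact Or.inl h
    · rcases hf with rfl | hf
      · rcases hv with rfl | rfl
        · exact h1
        · exact h2
      · exact Or.inr ⟨f, hf, hv⟩
  · rintro (h | ⟨f, hf, hv⟩)
    · exact Or.inl h
    · exact Or.inr ⟨f, Or.inr hf, hv⟩

theorem mem_verts_insert {x : V} {E : Set (V × V)} {e : V × V} (h1 : e.1 ∈ verts x E) {v : V} :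
    v ∈ verts x (insert e E) ↔ v = e.2 ∨ v ∈ verts x E := by
  constructor
  · rintro (h | ⟨f, hf, hv⟩)
    · exact Or.inr (Or.inl h)
    · rcases hf with rfl | hf
      · rcases hv with rfl | rfl
        · exact Or.inr h1
        · exact Or.inl rfl
      · exact Or.inr (Or.inr ⟨f, hf, hv⟩)
  · rintro (h | h | ⟨f, hf, hv⟩)
    · exact Or.inr ⟨e, Or.inl rfl, Or.inr h⟩
    · exact Or.inl h
    · exact Or.inr ⟨f, Or.inr hf, hv⟩

theorem IsPath.mono {E F : Set (V × V)} (h : E ⊆ F) {x y : V} {k : ℕ} {p : Fin (k + 1) → V}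
    (hp : IsPath E x y p) : IsPath F x y p :=
  ⟨hp.1, hp.2.1, fun i => h (hp.2.2 i)⟩

/-- Adding an edge to a new vertex keeps the tree structure. -/
theorem IsDirectedTree.insert_edge {x v w : V} {W : Set V} {T : Set (V × V)}
    (h : IsDirectedTree x W T) (hv : v ∈ W) (hw : w ∉ W) :
    IsDirectedTree x (insert w W) (insert (v, w) T) := by
  obtain ⟨hx, hT, hu⟩ := h
  have key : ∀ {y : V}, y ≠ w → ∀ {k : ℕ} {p : Fin (k + 1) → V},
      IsPath (insert (v, w) T) x y p → IsPath T x y p := by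
    intro y hy k p hp
    refine ⟨hp.1, hp.2.1, fun i => ?_⟩
    rcases hp.2.2 i with hi | hi
    · exfalso
      have hiw : p i.succ = w := congrArg Prod.snd hi
      by_cases hk : (i : ℕ) + 1 < k
      · have h2 := hp.2.2 ⟨i + 1, hk⟩
        have he : (Fin.castSucc ⟨(i : ℕ) + 1, hk⟩ : Fin (k + 1)) = i.succ := by
          ext; simp
        rw [he, hiw] at h2
        rcases h2 with h2 | h2
        · have : w = v := congrArg Prod.fst h2
          exact hw (this ▸ hv)
        · exact hw (hT _ h2).1
      · have : i.succ = Fin.last k := by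
          ext; simp; omega
        rw [this, hp.2.1] at hiw
        exact hy hiw
    · exact hi
  refine ⟨Or.inr hx, ?_, ?_⟩
  · rintro e (rfl | he)
    · exact ⟨Or.inr hv, Or.inl rfl⟩
    · exact ⟨Or.inr (hT e he).1, Or.inr (hT e he).2⟩
  · rintro y (rfl | hy)
    · obtain ⟨⟨k, q⟩, hq, huq⟩ := hu v hv
      refine ⟨⟨k + 1, Fin.snoc q y⟩, ⟨?_, ?_, ?_⟩, ?_⟩
      · have : (0 : Fin (k + 1 + 1)) = Fin.castSucc 0 := rfl
        simp only
        rw [this, Fin.snoc_castSucc]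
        exact hq.1
      · simp
      · intro i
        refine Fin.lastCases ?_ (fun j => ?_) i
        · left
          simp only [Fin.snoc_castSucc, Fin.succ_last, Fin.snoc_last]
          exact congrArg (fun a => (a, y)) hq.2.1
        · right
          have : (Fin.castSucc j).succ = Fin.castSucc j.succ := rfl
          simp only
          rw [this, Fin.snoc_castSucc, Fin.snoc_castSucc]
          exact hq.2.2 j
      · rintro ⟨k', r⟩ hr
        simp only at hr
        cases k' with
        | zero =>
          exfalso
          have h0 : r 0 = y := hr.2.1
          rw [hr.1] at h0
          exact hw (h0 ▸ hx)
        | succ k' =>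
          have hlast := hr.2.2 (Fin.last k')
          have hl : r (Fin.last k').succ = y := hr.2.1
          rw [hl] at hlast
          have hrv : r (Fin.last k').castSucc = v := by
            rcases hlast with h1 | h1
            · exact congrArg Prod.fst h1
            · exact absurd (hT _ h1).2 hw
          have hinit : IsPath T x v (Fin.init r) := by
            apply key (fun hvw => hw (hvw ▸ hv))
            exact ⟨hr.1, hrv, fun i => hr.2.2 i.castSucc⟩
          have := huq ⟨k', Fin.init r⟩ hinit
          obtain ⟨rfl, h2⟩ := Sigma.mk.inj_iff.1 this
          have h3 : Fin.init r = q := eq_of_heq h2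
          have h4 : r = Fin.snoc q y := by
            rw [← Fin.snoc_init_self r, h3]
            congr 1
          rw [h4]
    · obtain ⟨q, hq, huq⟩ := hu y hy
      refine ⟨q, hq.mono (Set.subset_insert _ _), fun r hr => huq r (key ?_ hr)⟩
      rintro rfl
      exact hw hy

/-- Throughout the algorithm, the tree is a directed tree spanning the explored subgraph. -/
theorem Exploration.isDirectedTree {G : Digraph V} {x : V} {s : ℕ} {θ : ℝ} {E T : Set (V × V)}
    (h : Exploration G x s θ E T) : IsDirectedTree x (verts x E) T := by
  induction h with
  | init =>
    refine ⟨root_mem_verts x _, by simp, ?_⟩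
    rintro v (rfl | ⟨e, he, -⟩)
    · refine ⟨⟨0, fun _ => v⟩, ⟨rfl, rfl, fun i => i.elim0⟩, ?_⟩
      rintro ⟨k, p⟩ hp
      cases k with
      | zero =>
        congr 1
        funext i
        obtain rfl : i = 0 := by ext; simp
        exact hp.1
      | succ k => exact absurd (hp.2.2 0) (Set.notMem_empty _)
    · exact absurd he (Set.notMem_empty _)
  | @keep E T e _ he hnew ih =>
    have : verts x (insert e E) = insert e.2 (verts x E) := by
      ext v
      exact mem_verts_insert he.1.2.1
    rw [this]
    exact ih.insert_edge he.1.2.1 hnew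
  | @discard E T e _ he hold ih =>
    rw [verts_insert_of_mem he.1.2.1 hold]
    exact ih

/-- The algorithm terminates: an output always exists. -/
theorem exists_isGreedyTree [Finite V] (G : Digraph V) (x : V) (s : ℕ) (θ : ℝ) :
    ∃ T, IsGreedyTree G x s θ T := by
  suffices H : ∀ N : ℕ, ∀ E T : Set (V × V), Set.ncard Eᶜ ≤ N → Exploration G x s θ E T →
      ∃ T, IsGreedyTree G x s θ T from H _ ∅ ∅ le_rfl .init
  intro N
  induction N with
  | zero =>
    intro E T hN hr
    refine ⟨T, E, hr, ?_⟩
    rintro ⟨e, he⟩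
    have h0 : Eᶜ = ∅ := (Set.ncard_eq_zero (Set.toFinite _)).1 (Nat.le_zero.1 hN)
    have : e ∈ Eᶜ := he.1.2.2
    rw [h0] at this
    exact this
  | succ N ih =>
    intro E T hN hr
    by_cases hc : ∃ e, IsChoice G x s θ E T e
    · obtain ⟨e, he⟩ := hc
      have hlt : Set.ncard (insert e E)ᶜ ≤ N := by
        have : Set.ncard (insert e E)ᶜ < Set.ncard Eᶜ := by
          apply Set.ncard_lt_ncard _ (Set.toFinite _)
          refine ⟨Set.compl_subset_compl.2 (Set.subset_insert _ _), fun hsub => ?_⟩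
          exact hsub he.1.2.2 (Set.mem_insert _ _)
        omega
      by_cases hw : e.2 ∈ verts x E
      · exact ih _ _ hlt (.discard hr he hw)
      · exact ih _ _ hlt (.keep hr he hw)
    · exact ⟨T, E, hr, hc⟩

end Graph

/-! ### The Chung–Lu digraph -/

/-- Configurations of oriented edges on `n` vertices: `ω (x, y) = true` means `x → y`. -/
abbrev EdgeConfig (n : ℕ) : Type := Fin n × Fin n → Bool

/-- The realization of the graph given by an edge configuration. -/
def toDigraph {n : ℕ} (ω : EdgeConfig n) : Digraph (Fin n) where
  Adj x y := ω (x, y) = true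

/-- The connection probability `p_{xy} = (w_x^+ w_y^- log n / n) ∧ 1` for `x ≠ y`, and `p_{xx} = 0`
(no loops). `Set.projIcc 0 1` truncates to `[0, 1]`; for positive weights it is just `· ∧ 1`. -/
def edgeProb {n : ℕ} (wOut wIn : Fin n → ℝ) (x y : Fin n) : unitInterval :=
  if x = y then 0
  else Set.projIcc (0 : ℝ) 1 zero_le_one (wOut x * wIn y * (Real.log n / n))

/-- The law `ℙ` of the Chung–Lu digraph: edges are present independently, with probabilities
`p_{xy}`. -/
def graphLaw {n : ℕ} (wOut wIn : Fin n → ℝ) : Measure (EdgeConfig n) :=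
  Measure.pi fun e : Fin n × Fin n => bernoulliMeasure true false (edgeProb wOut wIn e.1 e.2)

/-- The in-degree distribution `μ_in(x) = w_x^- / 𝐰`. -/
def muIn {n : ℕ} (wIn : Fin n → ℝ) (x : Fin n) : ℝ := wIn x / ∑ y, wIn y

/-- The entropy `H`: the mean of `log (D_V^+ ∨ 1)`, where `V` has law `μ_in` and is independent of
the graph. -/
def entropy {n : ℕ} (wOut wIn : Fin n → ℝ) : ℝ :=
  ∑ x, muIn wIn x *
    ∫ ω, Real.log (max (outDegree (toDigraph ω) x : ℝ) 1) ∂(graphLaw wOut wIn)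

/-- The entropic time `t_ent = log n / H`. -/
def entropicTime {n : ℕ} (wOut wIn : Fin n → ℝ) : ℝ := Real.log n / entropy wOut wIn

/-- The (integer part of the) radius `h_ε = ε log n / (20 H)`. -/
def radius {n : ℕ} (wOut wIn : Fin n → ℝ) (ε : ℝ) : ℕ :=
  ⌊ε * Real.log n / (20 * entropy wOut wIn)⌋₊

/-- The random set `V_ε` of `h_ε`-roots. -/
def epsRoots {n : ℕ} (wOut wIn : Fin n → ℝ) (ε : ℝ) (ω : EdgeConfig n) : Set (Fin n) :=
  treeRoots (toDigraph ω) (radius wOut wIn ε)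

/-- The mass threshold `exp (-(1 + γ) H s)` of the exploration. -/
def massThreshold {n : ℕ} (wOut wIn : Fin n → ℝ) (γ : ℝ) (s : ℕ) : ℝ :=
  Real.exp (-((1 + γ) * entropy wOut wIn * s))

end ChungLu

end

noncomputable section

namespace ChungLu

/-! ### Paths -/

section Paths

variable {V : Type*}

/-! With high probability all out-degrees lie in one window `[a, b] = [c log n, C log n]`. The lower
tail survives a union bound over the vertices because the mean out-degree is at least `M₀ log n`
with `M₀ > 1`. Hence `H = log log n + O(1)` (`entropy_bounds`), and a path of length `k` has mass
between `b⁻ᵏ` and `a⁻ᵏ`.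

Since `log b ≤ (1 + γ) H` for large `n`, the threshold `exp(-(1 + γ) H s)` is at most `b⁻ˢ`, so it
never stops the exploration: every edge whose tail has tree depth less than `s` gets visited. The
mass missing at depth `s` is therefore at most the cumulative mass of the discarded edges
(`IsLabelling.one_sub_totalPathMass_le`).

Discarded edges are charged to the excess edges of the breadth-first exploration, namely those whose
head is already known or is also hit by a smaller tail of the same sphere. A discarded excess edge
pays for itself. A discarded non-excess edge shares its head with a kept edge; distinct non-excess
edges have distinct heads, so the kept edge is excess, and by greediness it is at least as heavy.
The charging is injective, whence the loss is at most `∑ j < s, |excessAt j| a^{-(j+1)}`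
(`IsGreedyTree.one_sub_totalPathMass_le`).

Given the ball of radius `j`, the edges leaving the sphere are fresh. Each tail produces excess
edges at rate at most `q = M₁ log n √(K M / n)`, where `K` bounds the number of known vertices and
`M` comes from the second moment of the in-weights. A Chernoff bound gives `|excessAt j| ≤ 4 b^{j+1}
q + 3 log n` for all roots and levels simultaneously (`measureReal_excessAt_le`). For `x ∈ V_ε` the
levels `j < h_ε` contribute nothing, so the loss is at most `s (4 (b/a)ˢ q + 3 log n a^{-h_ε})`.
This tends to zero: `(b/a)ˢ = e^{O(s)}` is a small power of `n`, while `q` and `a^{-h_ε}` decay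
polynomially. The same estimate up to radius `h_ε` around one fixed vertex shows `V_ε ≠ ∅`. -/

theorem isPath_zero_iff {E : Set (V × V)} {x y : V} {p : Fin 1 → V} :
    IsPath E x y p ↔ p 0 = x ∧ x = y := by
  constructor
  · rintro ⟨h0, h1, -⟩
    exact ⟨h0, h0.symm.trans h1⟩
  · rintro ⟨h0, rfl⟩
    exact ⟨h0, h0, fun i => i.elim0⟩

theorem IsPath.snoc {E : Set (V × V)} {x y z : V} {k : ℕ} {p : Fin (k + 1) → V}
    (hp : IsPath E x y p) (h : (y, z) ∈ E) :
    IsPath E x z (Fin.snoc p z : Fin (k + 1 + 1) → V) := by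
  refine ⟨?_, by simp, fun i => ?_⟩
  · have h0 : (0 : Fin (k + 1 + 1)) = Fin.castSucc 0 := rfl
    rw [h0, Fin.snoc_castSucc]
    exact hp.1
  · refine Fin.lastCases ?_ (fun j => ?_) i
    · rw [Fin.snoc_castSucc, Fin.succ_last, Fin.snoc_last, hp.2.1]
      exact h
    · have h1 : (Fin.castSucc j).succ = Fin.castSucc j.succ := rfl
      rw [h1, Fin.snoc_castSucc, Fin.snoc_castSucc]
      exact hp.2.2 j

theorem IsPath.init {E : Set (V × V)} {x z : V} {k : ℕ} {p : Fin (k + 1 + 1) → V}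
    (hp : IsPath E x z p) :
    IsPath E x (p (Fin.last k).castSucc) (Fin.init p : Fin (k + 1) → V) ∧
      (p (Fin.last k).castSucc, z) ∈ E := by
  refine ⟨⟨hp.1, rfl, fun i => hp.2.2 i.castSucc⟩, ?_⟩
  have h1 := hp.2.2 (Fin.last k)
  rw [Fin.succ_last, hp.2.1] at h1
  exact h1

theorem isPath_snoc_iff {E : Set (V × V)} {x y z : V} {k : ℕ} {p : Fin (k + 1) → V} :
    IsPath E x z (Fin.snoc p y : Fin (k + 1 + 1) → V) ↔
      y = z ∧ IsPath E x (p (Fin.last k)) p ∧ (p (Fin.last k), y) ∈ E := by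
  constructor
  · intro h
    have hy : y = z := by simpa using h.2.1
    subst hy
    simpa using h.init
  · rintro ⟨rfl, h1, h2⟩
    exact h1.snoc h2

theorem pathMass_snoc (G : Digraph V) {k : ℕ} (p : Fin (k + 1) → V) (y : V) :
    pathMass G (Fin.snoc p y : Fin (k + 1 + 1) → V) =
      pathMass G p * stepProb G (p (Fin.last k)) y := by
  unfold pathMass
  rw [Fin.prod_univ_castSucc]
  congr 1
  · refine Finset.prod_congr rfl fun i _ => ?_
    have h1 : (Fin.castSucc i).succ = Fin.castSucc i.succ := rfl
    rw [h1, Fin.snoc_castSucc, Fin.snoc_castSucc]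
  · rw [Fin.snoc_castSucc, Fin.succ_last, Fin.snoc_last]

theorem pathMass_zero (G : Digraph V) (p : Fin 1 → V) : pathMass G p = 1 := by
  simp [pathMass]

end Paths

/-! ### Balls, spheres and excess edges -/

section Balls

variable {V : Type*} [Fintype V]

open Classical in
/-- The out-neighbours of a vertex. -/
def outNbrs (G : Digraph V) (u : V) : Finset V := Finset.univ.filter (G.Adj u)

theorem mem_outNbrs {G : Digraph V} {u w : V} : w ∈ outNbrs G u ↔ G.Adj u w := by simp [outNbrs]

theorem outDegree_eq_card (G : Digraph V) (u : V) : outDegree G u = (outNbrs G u).card := by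
  rw [outDegree, ← Set.ncard_coe_finset]
  congr 1
  ext w
  simp [mem_outNbrs]

variable [LinearOrder V]

/-- The set of heads of the edges with tail in `L`. -/
def outNbhd (G : Digraph V) (L : Finset V) : Finset V := L.biUnion (outNbrs G)

/-- The vertices at distance at most `j` from `x`. -/
def ball (G : Digraph V) (x : V) : ℕ → Finset V
  | 0 => {x}
  | j + 1 => ball G x j ∪ outNbhd G (ball G x j)

/-- The vertices at distance less than `j` from `x`. -/
def innerBall (G : Digraph V) (x : V) : ℕ → Finset V
  | 0 => ∅
  | j + 1 => ball G x j

/-- The vertices at distance exactly `j` from `x`. -/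
def sphere (G : Digraph V) (x : V) (j : ℕ) : Finset V := ball G x j \ innerBall G x j

open Classical in
/-- The edges with tail in `L` whose head lies in `B` or is also the head of an edge with smaller
tail in `L`. -/
def excess (G : Digraph V) (L B : Finset V) : Finset (V × V) :=
  Finset.univ.filter fun e => e.1 ∈ L ∧ G.Adj e.1 e.2 ∧
    (e.2 ∈ B ∨ ∃ u ∈ L, u < e.1 ∧ G.Adj u e.2)

/-- The excess edges of the breadth-first exploration from `x` with tail at distance `j`. -/
def excessAt (G : Digraph V) (x : V) (j : ℕ) : Finset (V × V) :=
  excess G (sphere G x j) (ball G x j)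

variable {G : Digraph V} {x : V}

theorem mem_outNbhd {L : Finset V} {w : V} : w ∈ outNbhd G L ↔ ∃ u ∈ L, G.Adj u w := by
  simp [outNbhd, mem_outNbrs]

theorem mem_ball_succ {j : ℕ} {w : V} :
    w ∈ ball G x (j + 1) ↔ w ∈ ball G x j ∨ ∃ u ∈ ball G x j, G.Adj u w := by
  simp [ball, mem_outNbhd]

theorem ball_mono : Monotone (ball G x) :=
  monotone_nat_of_le_succ fun _ => Finset.subset_union_left

theorem innerBall_subset (j : ℕ) : innerBall G x j ⊆ ball G x j := by
  cases j with
  | zero => exact Finset.empty_subset _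
  | succ j => exact ball_mono (Nat.le_succ j)

theorem ball_subset_innerBall {i j : ℕ} (h : i < j) : ball G x i ⊆ innerBall G x j := by
  cases j with
  | zero => omega
  | succ j => exact ball_mono (Nat.lt_succ_iff.1 h)

theorem outNbhd_innerBall_subset (j : ℕ) : outNbhd G (innerBall G x j) ⊆ ball G x j := by
  cases j with
  | zero => simp [innerBall, outNbhd]
  | succ j => exact Finset.subset_union_right

theorem mem_sphere {j : ℕ} {v : V} :
    v ∈ sphere G x j ↔ v ∈ ball G x j ∧ v ∉ innerBall G x j := by
  simp [sphere]

theorem eq_of_mem_sphere {i j : ℕ} {v : V} (hi : v ∈ sphere G x i) (hj : v ∈ sphere G x j) :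
    i = j := by
  rw [mem_sphere] at hi hj
  rcases lt_trichotomy i j with h | h | h
  · exact absurd (ball_subset_innerBall h hi.1) hj.2
  · exact h
  · exact absurd (ball_subset_innerBall h hj.1) hi.2

theorem exists_mem_sphere {j : ℕ} {v : V} (h : v ∈ ball G x j) :
    ∃ i ≤ j, v ∈ sphere G x i := by
  induction j with
  | zero => exact ⟨0, le_rfl, mem_sphere.2 ⟨h, by simp [innerBall]⟩⟩
  | succ j ih =>
    by_cases hv : v ∈ ball G x j
    · obtain ⟨i, hi, hvi⟩ := ih hv
      exact ⟨i, by omega, hvi⟩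
    · exact ⟨j + 1, le_rfl, mem_sphere.2 ⟨h, hv⟩⟩

theorem IsPath.mem_ball {E : Set (V × V)} (hE : E ⊆ edges G) {k : ℕ} {y : V}
    {p : Fin (k + 1) → V} (hp : IsPath E x y p) : y ∈ ball G x k := by
  induction k generalizing y with
  | zero => simp [ball, (isPath_zero_iff.1 hp).2]
  | succ k ih =>
    obtain ⟨h1, h2⟩ := hp.init
    exact mem_ball_succ.2 (Or.inr ⟨_, ih h1, hE h2⟩)

/-- A vertex on the sphere of radius `j` is reached by a path of length `j`. -/
theorem exists_isPath_of_mem_sphere {j : ℕ} {v : V} (h : v ∈ sphere G x j) {m : ℕ} (hm : j ≤ m) :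
    ∃ p : Fin (j + 1) → V, IsPath {e | e ∈ edges G ∧ ∃ i < m, e.1 ∈ sphere G x i} x v p := by
  induction j generalizing v with
  | zero =>
    have : v = x := by simpa [sphere, ball, innerBall] using h
    exact ⟨fun _ => x, isPath_zero_iff.2 ⟨rfl, this.symm⟩⟩
  | succ j ih =>
    rw [mem_sphere] at h
    obtain ⟨u, hu, huv⟩ := (mem_ball_succ.1 h.1).resolve_left h.2
    have hus : u ∈ sphere G x j := by
      refine mem_sphere.2 ⟨hu, fun hu' => h.2 ?_⟩
      exact outNbhd_innerBall_subset j (mem_outNbhd.2 ⟨u, hu', huv⟩)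
    obtain ⟨p, hp⟩ := ih hus (by omega)
    exact ⟨_, hp.snoc ⟨huv, j, by omega, hus⟩⟩

theorem mem_outBall_iff {h : ℕ} {v : V} : v ∈ outBall G x h ↔ v ∈ ball G x h := by
  constructor
  · rintro ⟨k, hk, p, hp⟩
    exact ball_mono hk (hp.mem_ball le_rfl)
  · intro hv
    obtain ⟨i, hi, hvi⟩ := exists_mem_sphere hv
    obtain ⟨p, hp⟩ := exists_isPath_of_mem_sphere hvi le_rfl
    exact ⟨i, hi, p, hp.mono fun e he => he.1⟩

/-- A walk of length less than `h` may be replaced by a shortest one, so the ball edges are graded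
by the distance of their tail. -/
theorem outBallEdges_eq (h : ℕ) :
    outBallEdges G x h = {e | e ∈ edges G ∧ ∃ i < h, e.1 ∈ sphere G x i} := by
  ext e
  constructor
  · rintro ⟨he, k, hk, p, hp⟩
    obtain ⟨i, hi, hei⟩ := exists_mem_sphere (hp.mem_ball le_rfl)
    exact ⟨he, i, by omega, hei⟩
  · rintro ⟨he, i, hi, hei⟩
    obtain ⟨p, hp⟩ := exists_isPath_of_mem_sphere hei le_rfl
    exact ⟨he, i, hi, p, hp.mono fun e he => he.1⟩

/-! ### Excess edges as the obstruction to being a tree. -/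

theorem mem_excess {L B : Finset V} {e : V × V} : e ∈ excess G L B ↔
    e.1 ∈ L ∧ G.Adj e.1 e.2 ∧ (e.2 ∈ B ∨ ∃ u ∈ L, u < e.1 ∧ G.Adj u e.2) := by
  simp [excess]

theorem snd_mem_sphere_of_notMem_excessAt {j : ℕ} {e : V × V} (he : e ∈ edges G)
    (hj : e.1 ∈ sphere G x j) (hx : e ∉ excessAt G x j) : e.2 ∈ sphere G x (j + 1) := by
  refine mem_sphere.2 ⟨mem_ball_succ.2 (Or.inr ⟨_, (mem_sphere.1 hj).1, he⟩), fun h => hx ?_⟩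
  exact mem_excess.2 ⟨hj, he, Or.inl h⟩

/-- Distinct non-excess edges have distinct heads. -/
theorem eq_of_notMem_excessAt {i j : ℕ} {e f : V × V} (he : e ∈ edges G) (hf : f ∈ edges G)
    (hei : e.1 ∈ sphere G x i) (hfj : f.1 ∈ sphere G x j) (hex : e ∉ excessAt G x i)
    (hfx : f ∉ excessAt G x j) (h : e.2 = f.2) : e = f := by
  have h1 := snd_mem_sphere_of_notMem_excessAt he hei hex
  have h2 := snd_mem_sphere_of_notMem_excessAt hf hfj hfx
  rw [← h] at h2
  obtain rfl : i = j := by have := eq_of_mem_sphere h1 h2; omega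
  refine Prod.ext ?_ h
  rcases lt_trichotomy e.1 f.1 with hlt | heq | hlt
  · refine absurd (mem_excess.2 ⟨hfj, hf, Or.inr ⟨e.1, hei, hlt, ?_⟩⟩) hfx
    rw [← h]; exact he
  · exact heq
  · refine absurd (mem_excess.2 ⟨hei, he, Or.inr ⟨f.1, hfj, hlt, ?_⟩⟩) hex
    rw [h]; exact hf

/-- An excess edge gives its head two paths: through the edge itself, and either a path of length at
most `j` or one of the same length with another last step. -/
theorem excessAt_eq_empty_of_mem_treeRoots {h j : ℕ} (hx : x ∈ treeRoots G h) (hj : j < h) :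
    excessAt G x j = ∅ := by
  obtain ⟨-, -, hu⟩ := hx
  rw [outBallEdges_eq] at hu
  rw [Finset.eq_empty_iff_forall_notMem]
  rintro ⟨u, w⟩ he
  obtain ⟨h1, h2, h3⟩ := mem_excess.1 he
  obtain ⟨p, hp⟩ := exists_isPath_of_mem_sphere h1 hj.le
  have hpw := hp.snoc (z := w) ⟨h2, j, hj, h1⟩
  have hw : w ∈ outBall G x h :=
    mem_outBall_iff.2 (ball_mono hj (mem_ball_succ.2 (Or.inr ⟨u, (mem_sphere.1 h1).1, h2⟩)))
  rcases h3 with h3 | ⟨u', hu', hlt, hadj⟩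
  · obtain ⟨i, hi, hwi⟩ := exists_mem_sphere h3
    obtain ⟨q, hq⟩ := exists_isPath_of_mem_sphere hwi (m := h) (by omega)
    have := (hu w hw).unique (y₁ := ⟨_, _⟩) (y₂ := ⟨_, _⟩) hpw hq
    have := congrArg Sigma.fst this
    simp at this
    omega
  · obtain ⟨p', hp'⟩ := exists_isPath_of_mem_sphere hu' hj.le
    have hpw' := hp'.snoc (z := w) ⟨hadj, j, hj, hu'⟩
    have h4 := (hu w hw).unique (y₁ := ⟨_, _⟩) (y₂ := ⟨_, _⟩) hpw hpw'
    have h5 : (Fin.snoc p w : Fin (j + 1 + 1) → V) = Fin.snoc p' w :=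
      eq_of_heq (Sigma.mk.inj_iff.1 h4).2
    have h6 := congrFun h5 (Fin.last j).castSucc
    rw [Fin.snoc_castSucc, Fin.snoc_castSucc, hp.2.1, hp'.2.1] at h6
    exact hlt.ne h6.symm

/-- Without excess edges every step moves one sphere outwards and every vertex has a single
predecessor: the length of a path is then fixed by its endpoint (`key`), and so is the path
(`uniq`). -/
theorem mem_treeRoots_of_excessAt_eq_empty {h : ℕ} (hx : ∀ j < h, excessAt G x j = ∅) :
    x ∈ treeRoots G h := by
  refine ⟨mem_outBall_iff.2 (ball_mono (Nat.zero_le h) (by simp [ball])), ?_, ?_⟩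
  · rw [outBallEdges_eq]
    rintro e ⟨he, i, hi, hei⟩
    rw [mem_outBall_iff, mem_outBall_iff]
    have h1 := (mem_sphere.1 hei).1
    exact ⟨ball_mono hi.le h1, ball_mono hi (mem_ball_succ.2 (Or.inr ⟨_, h1, he⟩))⟩
  · rw [outBallEdges_eq]
    have key : ∀ (k : ℕ) (v : V) (p : Fin (k + 1) → V),
        IsPath {e | e ∈ edges G ∧ ∃ i < h, e.1 ∈ sphere G x i} x v p → v ∈ sphere G x k := by
      intro k
      induction k with
      | zero =>
        intro v p hp
        rw [← (isPath_zero_iff.1 hp).2]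
        simp [sphere, ball, innerBall]
      | succ k ih =>
        intro v p hp
        obtain ⟨h1, h2, i, hi, hs⟩ := hp.init
        obtain rfl : i = k := eq_of_mem_sphere hs (ih _ _ h1)
        exact snd_mem_sphere_of_notMem_excessAt (e := (_, v)) h2 hs (by simp [hx i hi])
    have uniq : ∀ (k : ℕ) (v : V) (p q : Fin (k + 1) → V),
        IsPath {e | e ∈ edges G ∧ ∃ i < h, e.1 ∈ sphere G x i} x v p →
        IsPath {e | e ∈ edges G ∧ ∃ i < h, e.1 ∈ sphere G x i} x v q → p = q := by
      intro k
      induction k with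
      | zero =>
        intro v p q hp hq
        funext i
        obtain rfl : i = 0 := by ext; simp
        rw [hp.1, hq.1]
      | succ k ih =>
        intro v p q hp hq
        obtain ⟨h1, h2, i, hi, hs⟩ := hp.init
        obtain ⟨h1', h2', i', hi', hs'⟩ := hq.init
        have h3 : p (Fin.last k).castSucc = q (Fin.last k).castSucc :=
          congrArg Prod.fst (eq_of_notMem_excessAt (e := (_, v)) (f := (_, v)) h2 h2' hs hs'
            (by simp [hx i hi]) (by simp [hx i' hi']) rfl)
        rw [← h3] at h1'
        have h4 := ih _ _ _ h1 h1'
        rw [← Fin.snoc_init_self p, ← Fin.snoc_init_self q, h4, hp.2.1, hq.2.1]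
    intro v hv
    obtain ⟨i, hi, hvi⟩ := exists_mem_sphere (mem_outBall_iff.1 hv)
    obtain ⟨p, hp⟩ := exists_isPath_of_mem_sphere hvi hi
    refine ⟨⟨i, p⟩, hp, ?_⟩
    rintro ⟨k, q⟩ hq
    obtain rfl := eq_of_mem_sphere hvi (key _ _ _ hq)
    rw [uniq _ _ _ _ hp hq]

/-- If out-degrees are at most `b`, the ball of radius `j` has at most `2 b ^ j` vertices. -/
theorem card_ball_le {b : ℝ} (hb : 2 ≤ b) (hdeg : ∀ v, (outDegree G v : ℝ) ≤ b) (j : ℕ) :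
    ((ball G x j).card : ℝ) ≤ 2 * b ^ j := by
  have hsph : ∀ j, ((sphere G x j).card : ℝ) ≤ b ^ j := by
    intro j
    induction j with
    | zero => simp [sphere, ball, innerBall]
    | succ j ih =>
      have hsub : sphere G x (j + 1) ⊆ outNbhd G (sphere G x j) := by
        intro w hw
        rw [mem_sphere] at hw
        obtain ⟨u, hu, huw⟩ := (mem_ball_succ.1 hw.1).resolve_left hw.2
        refine mem_outNbhd.2 ⟨u, mem_sphere.2 ⟨hu, fun hu' => hw.2 ?_⟩, huw⟩
        exact outNbhd_innerBall_subset j (mem_outNbhd.2 ⟨u, hu', huw⟩)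
      calc ((sphere G x (j + 1)).card : ℝ) ≤ ((outNbhd G (sphere G x j)).card : ℝ) := by
            exact_mod_cast Finset.card_le_card hsub
        _ ≤ ∑ u ∈ sphere G x j, ((outNbrs G u).card : ℝ) := by
            exact_mod_cast Finset.card_biUnion_le
        _ ≤ ∑ u ∈ sphere G x j, b := by
            refine Finset.sum_le_sum fun u _ => ?_
            rw [← outDegree_eq_card]
            exact hdeg u
        _ = (sphere G x j).card * b := by simp
        _ ≤ b ^ j * b := by gcongr
        _ = b ^ (j + 1) := by ring
  induction j with
  | zero => simp [ball]
  | succ j ih =>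
    have h1 : ball G x (j + 1) = ball G x j ∪ sphere G x (j + 1) := by
      ext w
      have := @ball_mono _ _ _ G x _ _ (Nat.le_succ j)
      simp only [Finset.mem_union, mem_sphere, innerBall]
      constructor
      · intro h
        by_cases hw : w ∈ ball G x j
        · exact Or.inl hw
        · exact Or.inr ⟨h, hw⟩
      · rintro (h | h)
        · exact this h
        · exact h.1
    have h2 : ((ball G x (j + 1)).card : ℝ) ≤ (ball G x j).card + (sphere G x (j + 1)).card := by
      rw [h1]
      exact_mod_cast Finset.card_union_le _ _
    have h3 := hsph (j + 1)
    -- Here `2 ≤ b` absorbs the geometric sum: `2 b ^ j + b ^ (j + 1) ≤ 2 b ^ (j + 1)`.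
    have h4 : b ^ (j + 1) = b ^ j * b := pow_succ _ _
    have h5 : 0 < b ^ j := by positivity
    nlinarith

end Balls

/-! ### Depths and masses along the exploration -/

section Exploration

variable {V : Type*} {G : Digraph V} {x : V} {s : ℕ} {θ : ℝ} {E T : Set (V × V)}

/-- The cumulative mass of an edge, in terms of the masses `ms` of the vertices. -/
def edgeMass (G : Digraph V) (ms : V → ℝ) (e : V × V) : ℝ :=
  ms e.1 * (1 / (outDegree G e.1 : ℝ))

/-- `dep` and `ms` record the depth in the tree `T` and the mass of the path of `T` from the root,
for a state `(E, T)` of the exploration. -/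
structure IsLabelling (G : Digraph V) (x : V) (s : ℕ) (E T : Set (V × V)) (dep : V → ℕ)
    (ms : V → ℝ) : Prop where
  subset : T ⊆ E
  edges : E ⊆ edges G
  dep_root : dep x = 0
  ms_root : ms x = 1
  dep_step : ∀ e ∈ T, dep e.2 = dep e.1 + 1
  ms_step : ∀ e ∈ T, ms e.2 = edgeMass G ms e
  nonneg : ∀ v, 0 ≤ ms v
  order : ∀ e ∈ E, ∀ f ∈ frontier G x E, dep f.1 + 1 ≤ s → edgeMass G ms f ≤ edgeMass G ms e
  kept : ∀ e ∈ E, e.2 = x ∨ ∃ t ∈ T, t.2 = e.2 ∧ edgeMass G ms e ≤ edgeMass G ms t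
  depth : ∀ e ∈ E, dep e.1 + 1 ≤ s

theorem stepProb_of_adj {u w : V} (h : G.Adj u w) :
    stepProb G u w = 1 / (outDegree G u : ℝ) := if_pos h

theorem stepProb_nonneg (G : Digraph V) (u w : V) : 0 ≤ stepProb G u w := by
  unfold stepProb
  split_ifs <;> positivity

theorem pathMass_nonneg (G : Digraph V) {k : ℕ} (p : Fin (k + 1) → V) : 0 ≤ pathMass G p :=
  Finset.prod_nonneg fun _ _ => stepProb_nonneg G _ _

theorem IsLabelling.of_isPath {dep : V → ℕ} {ms : V → ℝ} (hl : IsLabelling G x s E T dep ms)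
    {k : ℕ} {v : V} {p : Fin (k + 1) → V} (hp : IsPath T x v p) :
    dep v = k ∧ pathMass G p = ms v := by
  induction k generalizing v with
  | zero =>
    rw [← (isPath_zero_iff.1 hp).2, hl.dep_root, hl.ms_root, pathMass_zero]
    exact ⟨rfl, rfl⟩
  | succ k ih =>
    obtain ⟨h1, h2⟩ := hp.init
    obtain ⟨h3, h4⟩ := ih h1
    have h5 := hl.dep_step _ h2
    have h6 := hl.ms_step _ h2
    refine ⟨by simpa [h3] using h5, ?_⟩
    rw [← Fin.snoc_init_self p, pathMass_snoc, hp.2.1, h6, h4]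
    have h7 : (Fin.init p : Fin (k + 1) → V) (Fin.last k) = p (Fin.last k).castSucc := rfl
    rw [h7, stepProb_of_adj (hl.edges (hl.subset h2))]
    rfl

theorem exists_isPath_of_mem_verts (hrun : Exploration G x s θ E T) {v : V}
    (hv : v ∈ verts x E) : ∃ (k : ℕ) (p : Fin (k + 1) → V), IsPath T x v p := by
  obtain ⟨⟨k, p⟩, hp, -⟩ := hrun.isDirectedTree.2.2 v hv
  exact ⟨k, p, hp⟩

/-- Tree paths are unique, so the existential over paths in the algorithm collapses to two functions
on vertices. -/
theorem IsLabelling.hasCumulativeMass_iff {dep : V → ℕ} {ms : V → ℝ}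
    (hl : IsLabelling G x s E T dep ms) (hrun : Exploration G x s θ E T) {e : V × V}
    (he : e.1 ∈ verts x E) {d : ℕ} {m : ℝ} :
    HasCumulativeMass G x T e d m ↔ d = dep e.1 ∧ m = edgeMass G ms e := by
  constructor
  · rintro ⟨p, hp, rfl⟩
    obtain ⟨h1, h2⟩ := hl.of_isPath hp
    rw [h2, h1]
    exact ⟨rfl, rfl⟩
  · rintro ⟨rfl, rfl⟩
    obtain ⟨k, p, hp⟩ := exists_isPath_of_mem_verts hrun he
    obtain ⟨rfl, h2⟩ := hl.of_isPath hp
    exact ⟨p, hp, by rw [h2]; rfl⟩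

theorem IsLabelling.isChoice_iff {dep : V → ℕ} {ms : V → ℝ}
    (hl : IsLabelling G x s E T dep ms) (hrun : Exploration G x s θ E T) {e : V × V} :
    IsChoice G x s θ E T e ↔ e ∈ frontier G x E ∧ dep e.1 + 1 ≤ s ∧ θ ≤ edgeMass G ms e ∧
      ∀ f ∈ frontier G x E, dep f.1 + 1 ≤ s → edgeMass G ms f ≤ edgeMass G ms e := by
  constructor
  · rintro ⟨he, d, m, hc, hd, hθ, hmax⟩
    obtain ⟨rfl, rfl⟩ := (hl.hasCumulativeMass_iff hrun he.2.1).1 hc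
    refine ⟨he, hd, hθ, fun f hf hdf => ?_⟩
    exact hmax f hf _ _ ((hl.hasCumulativeMass_iff hrun hf.2.1).2 ⟨rfl, rfl⟩) hdf
  · rintro ⟨he, hd, hθ, hmax⟩
    refine ⟨he, _, _, (hl.hasCumulativeMass_iff hrun he.2.1).2 ⟨rfl, rfl⟩, hd, hθ, ?_⟩
    intro f hf d m hc hdf
    obtain ⟨rfl, rfl⟩ := (hl.hasCumulativeMass_iff hrun hf.2.1).1 hc
    exact hmax f hf hdf

theorem one_div_outDegree_le_one (G : Digraph V) (u : V) : 1 / (outDegree G u : ℝ) ≤ 1 := by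
  rcases Nat.eq_zero_or_pos (outDegree G u) with h | h
  · simp [h]
  · rw [div_le_one (by exact_mod_cast h)]
    exact_mod_cast h

theorem edgeMass_nonneg {ms : V → ℝ} (h : ∀ v, 0 ≤ ms v) (e : V × V) : 0 ≤ edgeMass G ms e :=
  mul_nonneg (h _) (by positivity)

/-- Every state of the exploration carries a labelling by depths and masses. -/
theorem Exploration.exists_isLabelling (hrun : Exploration G x s θ E T) :
    ∃ dep ms, IsLabelling G x s E T dep ms := by
  classical
  induction hrun with
  | init =>
    exact ⟨fun _ => 0, fun _ => 1, by simp, by simp, rfl, rfl, by simp, by simp, by simp,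
      by simp, by simp, by simp⟩
  | @keep E T e hrun he hnew ih =>
    obtain ⟨dep, ms, hl⟩ := ih
    obtain ⟨hef, hd, hθ, hmax⟩ := (hl.isChoice_iff hrun).1 he
    -- The head of `e` is new, so the update does not disturb any label already in use.
    set dep' := Function.update dep e.2 (dep e.1 + 1) with hdep'
    set ms' := Function.update ms e.2 (edgeMass G ms e) with hms'
    have hdv : ∀ v ∈ verts x E, dep' v = dep v := fun v hv =>
      Function.update_of_ne (fun h : v = e.2 => hnew (h ▸ hv)) _ _
    have hmv : ∀ v ∈ verts x E, ms' v = ms v := fun v hv =>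
      Function.update_of_ne (fun h : v = e.2 => hnew (h ▸ hv)) _ _
    have hem : ∀ f : V × V, f.1 ∈ verts x E → edgeMass G ms' f = edgeMass G ms f := by
      intro f hf
      rw [edgeMass, hmv _ hf, edgeMass]
    have hE1 : ∀ f ∈ E, f.1 ∈ verts x E := fun f hf => Or.inr ⟨f, hf, Or.inl rfl⟩
    have hE2 : ∀ f ∈ E, f.2 ∈ verts x E := fun f hf => Or.inr ⟨f, hf, Or.inr rfl⟩
    have he1 : e.1 ∈ verts x E := hef.2.1
    have hde : dep' e.2 = dep e.1 + 1 := Function.update_self ..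
    have hme : ms' e.2 = edgeMass G ms e := Function.update_self ..
    refine ⟨dep', ms', Set.insert_subset_insert hl.subset,
      Set.insert_subset hef.1 hl.edges, ?_, ?_, ?_, ?_, ?_, ?_, ?_, ?_⟩
    · rw [hdv _ (root_mem_verts x E), hl.dep_root]
    · rw [hmv _ (root_mem_verts x E), hl.ms_root]
    · rintro f (rfl | hf)
      · rw [hde, hdv _ he1]
      · rw [hdv _ (hE2 f (hl.subset hf)), hdv _ (hE1 f (hl.subset hf)), hl.dep_step f hf]
    · rintro f (rfl | hf)
      · rw [hme, hem _ he1]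
      · rw [hmv _ (hE2 f (hl.subset hf)), hem _ (hE1 f (hl.subset hf)), hl.ms_step f hf]
    · intro v
      rcases eq_or_ne v e.2 with rfl | hv
      · rw [hme]; exact edgeMass_nonneg hl.nonneg e
      · rw [hms', Function.update_of_ne hv]; exact hl.nonneg v
    · intro f hf g hg hdg
      have hfe : edgeMass G ms e ≤ edgeMass G ms' f := by
        rcases hf with rfl | hf
        · rw [hem _ he1]
        · rw [hem _ (hE1 f hf)]
          exact hl.order f hf e hef hd
      -- Frontier edges are either out of the new vertex, where dividing by a degree can only lower
      -- the mass, or old ones, beaten by the maximality of `e`.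
      rcases (mem_verts_insert he1).1 hg.2.1 with hg1 | hg1
      · refine le_trans ?_ hfe
        rw [edgeMass, hg1, hme]
        exact mul_le_of_le_one_right (edgeMass_nonneg hl.nonneg e)
          (one_div_outDegree_le_one G _)
      · refine le_trans ?_ hfe
        rw [hem _ hg1]
        rw [hdv _ hg1] at hdg
        exact hmax g ⟨hg.1, hg1, fun h => hg.2.2 (Or.inr h)⟩ hdg
    · rintro f (rfl | hf)
      · exact Or.inr ⟨f, Or.inl rfl, rfl, le_rfl⟩
      · rcases hl.kept f hf with h | ⟨t, ht, h1, h2⟩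
        · exact Or.inl h
        · refine Or.inr ⟨t, Or.inr ht, h1, ?_⟩
          rwa [hem _ (hE1 f hf), hem _ (hE1 t (hl.subset ht))]
    · rintro f (rfl | hf)
      · rwa [hdv _ he1]
      · rw [hdv _ (hE1 f hf)]
        exact hl.depth f hf
  | @discard E T e hrun he hold ih =>
    obtain ⟨dep, ms, hl⟩ := ih
    obtain ⟨hef, hd, hθ, hmax⟩ := (hl.isChoice_iff hrun).1 he
    refine ⟨dep, ms, hl.subset.trans (Set.subset_insert _ _),
      Set.insert_subset hef.1 hl.edges, hl.dep_root, hl.ms_root, hl.dep_step, hl.ms_step,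
      hl.nonneg, ?_, ?_, ?_⟩
    · intro f hf g hg hdg
      have hfe : edgeMass G ms e ≤ edgeMass G ms f := by
        rcases hf with rfl | hf
        · exact le_rfl
        · exact hl.order f hf e hef hd
      refine (hmax g ⟨hg.1, ?_, fun h => hg.2.2 (Or.inr h)⟩ hdg).trans hfe
      rw [← verts_insert_of_mem hef.2.1 hold]
      exact hg.2.1
    · rintro f (rfl | hf)
      · obtain ⟨k, p, hp⟩ := exists_isPath_of_mem_verts hrun hold
        cases k with
        | zero => exact Or.inl (isPath_zero_iff.1 hp).2.symm
        | succ k =>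
          obtain ⟨-, h2⟩ := hp.init
          exact Or.inr ⟨_, h2, rfl, hl.order _ (hl.subset h2) f hef hd⟩
      · exact hl.kept f hf
    · rintro f (rfl | hf)
      · exact hd
      · exact hl.depth f hf

/-- If the threshold is below all relevant masses, the exploration stops only once all edges with
tail at depth less than `s` have been visited. -/
theorem IsLabelling.mem_of_stopped [Finite V] {dep : V → ℕ} {ms : V → ℝ}
    (hl : IsLabelling G x s E T dep ms) (hrun : Exploration G x s θ E T)
    (hdone : ¬ ∃ e, IsChoice G x s θ E T e)
    (hθ : ∀ e ∈ frontier G x E, dep e.1 + 1 ≤ s → θ ≤ edgeMass G ms e)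
    {e : V × V} (he : e ∈ ChungLu.edges G) (hv : e.1 ∈ verts x E) (hd : dep e.1 + 1 ≤ s) :
    e ∈ E := by
  by_contra hE
  -- A heaviest unvisited edge among those of admissible depth would be a legal choice.
  obtain ⟨f, ⟨hf, hdf⟩, hmax⟩ := Set.exists_max_image {f | f ∈ frontier G x E ∧ dep f.1 + 1 ≤ s}
    (edgeMass G ms) (Set.toFinite _) ⟨e, ⟨he, hv, hE⟩, hd⟩
  exact hdone ⟨f, (hl.isChoice_iff hrun).2 ⟨hf, hdf, hθ f hf hdf, fun g hg hdg =>
    hmax g ⟨hg, hdg⟩⟩⟩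

theorem pathMass_bounds {a b : ℝ} (ha : 1 ≤ a)
    (hdeg : ∀ v, a ≤ (outDegree G v : ℝ) ∧ (outDegree G v : ℝ) ≤ b) {k : ℕ} {v : V}
    {p : Fin (k + 1) → V} (hp : IsPath (ChungLu.edges G) x v p) :
    (b ^ k)⁻¹ ≤ pathMass G p ∧ pathMass G p ≤ (a ^ k)⁻¹ := by
  have ha0 : 0 < a := by linarith
  have hb0 : 0 < b := lt_of_lt_of_le ha0 ((hdeg x).1.trans (hdeg x).2)
  have hstep : ∀ i : Fin k, b⁻¹ ≤ stepProb G (p i.castSucc) (p i.succ) ∧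
      stepProb G (p i.castSucc) (p i.succ) ≤ a⁻¹ := by
    intro i
    rw [stepProb_of_adj (hp.2.2 i), one_div]
    exact ⟨inv_anti₀ (lt_of_lt_of_le ha0 (hdeg _).1) (hdeg _).2, inv_anti₀ ha0 (hdeg _).1⟩
  unfold pathMass
  rw [← inv_pow, ← inv_pow]
  constructor
  · calc b⁻¹ ^ k = ∏ _i : Fin k, b⁻¹ := by simp
      _ ≤ _ := Finset.prod_le_prod (fun _ _ => by positivity) fun i _ => (hstep i).1
  · calc _ ≤ ∏ _i : Fin k, a⁻¹ :=
          Finset.prod_le_prod (fun _ _ => stepProb_nonneg G _ _) fun i _ => (hstep i).2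
      _ = a⁻¹ ^ k := by simp

end Exploration

/-! ### Mass accounting -/

section Mass

variable {V : Type*} [Fintype V] {G : Digraph V} {x : V} {s : ℕ} {θ : ℝ} {E T : Set (V × V)}

open Classical in
/-- The total mass of the paths of length `k` from `x` to `v` with edges in `T`. -/
def massAt (G : Digraph V) (T : Set (V × V)) (x : V) (k : ℕ) (v : V) : ℝ :=
  ∑ p ∈ (Finset.univ : Finset (Fin (k + 1) → V)).filter (fun p => IsPath T x v p), pathMass G p

theorem massAt_nonneg (k : ℕ) (v : V) : 0 ≤ massAt G T x k v :=
  Finset.sum_nonneg fun _ _ => pathMass_nonneg G _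

theorem totalPathMass_eq_sum_massAt (k : ℕ) :
    totalPathMass G T x k = ∑ v, massAt G T x k v := rfl

theorem totalPathMass_zero : totalPathMass G T x 0 = 1 := by
  classical
  rw [totalPathMass_eq_sum_massAt, Finset.sum_eq_single x]
  · rw [massAt, Finset.sum_eq_single fun _ => x]
    · exact pathMass_zero G _
    · intro p hp hne
      refine absurd ?_ hne
      funext i
      obtain rfl : i = 0 := by ext; simp
      exact (isPath_zero_iff.1 (Finset.mem_filter.1 hp).2).1
    · intro h
      exact absurd (Finset.mem_filter.2 ⟨Finset.mem_univ _, isPath_zero_iff.2 ⟨rfl, rfl⟩⟩) h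
  · intro v _ hv
    refine Finset.sum_eq_zero fun p hp => ?_
    exact absurd (isPath_zero_iff.1 (Finset.mem_filter.1 hp).2).2.symm hv
  · simp

-- Splitting off the last vertex: the evolution equation of the walk killed when it leaves `T`.
open Classical in
theorem massAt_succ (k : ℕ) (w : V) :
    massAt G T x (k + 1) w =
      ∑ v, massAt G T x k v * (if (v, w) ∈ T then stepProb G v w else 0) := by
  have h1 : massAt G T x (k + 1) w = ∑ p : Fin (k + 1) → V,
      ∑ y : V, if IsPath T x w (Fin.snoc p y : Fin (k + 1 + 1) → V) then
        pathMass G (Fin.snoc p y : Fin (k + 1 + 1) → V) else 0 := by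
    rw [massAt, Finset.sum_filter, ← Finset.sum_product',
      ← (Fin.snocEquiv fun _ : Fin (k + 1 + 1) => V).sum_comp]
    refine Fintype.sum_equiv (Equiv.prodComm _ _) _ _ ?_
    rintro ⟨y, p⟩
    rfl
  have h2 : ∀ v, massAt G T x k v * (if (v, w) ∈ T then stepProb G v w else 0) =
      ∑ p : Fin (k + 1) → V, if IsPath T x v p then
        pathMass G p * (if (v, w) ∈ T then stepProb G v w else 0) else 0 := by
    intro v
    rw [massAt, Finset.sum_mul, Finset.sum_filter]
  simp_rw [h1, h2]
  rw [Finset.sum_comm (s := (Finset.univ : Finset V))]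
  refine Finset.sum_congr rfl fun p _ => ?_
  rw [Finset.sum_eq_single w, Finset.sum_eq_single (p (Fin.last k))]
  · rw [pathMass_snoc]
    simp only [isPath_snoc_iff, true_and]
    split_ifs <;> simp_all
  · intro v _ hv
    rw [if_neg fun h => hv h.2.1.symm]
  · simp
  · intro y _ hy
    rw [if_neg fun h => hy (isPath_snoc_iff.1 h).1]
  · simp

open Classical in
theorem totalPathMass_succ (k : ℕ) :
    totalPathMass G T x (k + 1) =
      ∑ v, massAt G T x k v * ∑ w, (if (v, w) ∈ T then stepProb G v w else 0) := by
  rw [totalPathMass_eq_sum_massAt]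
  simp_rw [massAt_succ, Finset.mul_sum]
  exact Finset.sum_comm

theorem sum_stepProb_eq (u : V) : ∑ w, stepProb G u w = outDegree G u / outDegree G u := by
  classical
  simp only [stepProb]
  rw [← Finset.sum_filter, Finset.sum_const, outDegree_eq_card, nsmul_eq_mul]
  rw [outNbrs, mul_one_div]

theorem sum_stepProb_le_one (u : V) : ∑ w, stepProb G u w ≤ 1 := by
  rw [sum_stepProb_eq]
  exact div_self_le_one _

theorem totalPathMass_le_one (k : ℕ) : totalPathMass G T x k ≤ 1 := by
  classical
  induction k with
  | zero => exact totalPathMass_zero.le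
  | succ k ih =>
    rw [totalPathMass_succ]
    refine le_trans (Finset.sum_le_sum fun v _ => ?_) ih
    refine mul_le_of_le_one_right (massAt_nonneg k v) (le_trans ?_ (sum_stepProb_le_one (G := G) v))
    refine Finset.sum_le_sum fun w _ => ?_
    split_ifs
    · exact le_rfl
    · exact stepProb_nonneg G v w

/-- Only an inequality is needed: at most one tree path ends at `v`, and its mass is the label. -/
theorem IsLabelling.massAt_le {dep : V → ℕ} {ms : V → ℝ} (hl : IsLabelling G x s E T dep ms)
    (hrun : Exploration G x s θ E T) (k : ℕ) (v : V) [Decidable (v ∈ verts x E ∧ dep v = k)] :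
    massAt G T x k v ≤ if v ∈ verts x E ∧ dep v = k then ms v else 0 := by
  classical
  have hT := hrun.isDirectedTree
  have hmem : ∀ p : Fin (k + 1) → V, IsPath T x v p → v ∈ verts x E ∧ dep v = k := by
    intro p hp
    refine ⟨?_, (hl.of_isPath hp).1⟩
    cases k with
    | zero => rw [← (isPath_zero_iff.1 hp).2]; exact root_mem_verts x E
    | succ k => exact (hT.2.1 _ hp.init.2).2
  split_ifs with h
  · obtain ⟨q, hq, huniq⟩ := hT.2.2 v h.1
    rw [massAt]
    have hcard : ((Finset.univ : Finset (Fin (k + 1) → V)).filter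
        (fun p => IsPath T x v p)).card ≤ 1 := by
      rw [Finset.card_le_one]
      intro p hp p' hp'
      have h1 := huniq ⟨k, p⟩ (Finset.mem_filter.1 hp).2
      have h2 := huniq ⟨k, p'⟩ (Finset.mem_filter.1 hp').2
      exact eq_of_heq (Sigma.mk.inj_iff.1 (h1.trans h2.symm)).2
    calc _ = ∑ p ∈ (Finset.univ : Finset (Fin (k + 1) → V)).filter
          (fun p => IsPath T x v p), ms v :=
          Finset.sum_congr rfl fun p hp => (hl.of_isPath (Finset.mem_filter.1 hp).2).2
      _ = (Finset.card ((Finset.univ : Finset (Fin (k + 1) → V)).filter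
          (fun p => IsPath T x v p)) : ℝ) * ms v := by simp
      _ ≤ 1 * ms v := by
          have := hl.nonneg v
          gcongr
          exact_mod_cast hcard
      _ = ms v := one_mul _
  · refine (Finset.sum_eq_zero fun p hp => ?_).le
    exact absurd (hmem p (Finset.mem_filter.1 hp).2) h

open Classical in
/-- The mass lost by the tree is at most the mass of the discarded edges. -/
theorem IsLabelling.one_sub_totalPathMass_le {dep : V → ℕ} {ms : V → ℝ}
    (hl : IsLabelling G x s E T dep ms) (hrun : Exploration G x s θ E T)
    (hdeg : ∀ v, 0 < outDegree G v)
    (hfull : ∀ e ∈ ChungLu.edges G, e.1 ∈ verts x E → dep e.1 + 1 ≤ s → e ∈ E) :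
    1 - totalPathMass G T x s ≤
      ∑ e ∈ (Finset.univ : Finset (V × V)).filter (fun e => e ∈ E ∧ e ∉ T), edgeMass G ms e := by
  have hstep : ∀ k, k < s → totalPathMass G T x k - totalPathMass G T x (k + 1) ≤
      ∑ e ∈ (Finset.univ : Finset (V × V)).filter (fun e => (e ∈ E ∧ e ∉ T) ∧ dep e.1 = k),
        edgeMass G ms e := by
    intro k hk
    rw [totalPathMass_succ, totalPathMass_eq_sum_massAt, ← Finset.sum_sub_distrib,
      Finset.sum_filter, ← Finset.univ_product_univ, Finset.sum_product]
    refine Finset.sum_le_sum fun v _ => ?_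
    -- Positive out-degree makes the rows of `P` sum to one, so the defect of a row of `T` is
    -- carried exactly by the missing edges.
    have hrow : (1 : ℝ) - ∑ w, (if (v, w) ∈ T then stepProb G v w else 0) =
        ∑ w, (if G.Adj v w ∧ (v, w) ∉ T then 1 / (outDegree G v : ℝ) else 0) := by
      have h1 : (1 : ℝ) = ∑ w, stepProb G v w := by
        rw [sum_stepProb_eq, div_self]
        exact_mod_cast (hdeg v).ne'
      conv_lhs => rw [h1]
      rw [← Finset.sum_sub_distrib]
      refine Finset.sum_congr rfl fun w _ => ?_
      unfold stepProb
      by_cases h2 : (v, w) ∈ T <;> by_cases h3 : G.Adj v w <;> simp [h2, h3]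
    rw [← mul_one_sub, hrow]
    have hle := hl.massAt_le hrun k v
    calc massAt G T x k v * ∑ w, (if G.Adj v w ∧ (v, w) ∉ T then 1 / (outDegree G v : ℝ) else 0)
        ≤ (if v ∈ verts x E ∧ dep v = k then ms v else 0) *
          ∑ w, (if G.Adj v w ∧ (v, w) ∉ T then 1 / (outDegree G v : ℝ) else 0) := by
          refine mul_le_mul_of_nonneg_right hle (Finset.sum_nonneg fun w _ => ?_)
          split_ifs <;> positivity
      _ ≤ _ := by
          rw [Finset.mul_sum]
          refine Finset.sum_le_sum fun w _ => ?_
          by_cases h1 : v ∈ verts x E ∧ dep v = k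
          · by_cases h2 : G.Adj v w ∧ (v, w) ∉ T
            · have h3 : (v, w) ∈ E := hfull (v, w) h2.1 h1.1 (by simp only; omega)
              rw [if_pos h1, if_pos h2, if_pos ⟨⟨h3, h2.2⟩, h1.2⟩]
              rfl
            · rw [if_neg h2, mul_zero]
              split_ifs
              · exact edgeMass_nonneg hl.nonneg _
              · exact le_rfl
          · rw [if_neg h1, zero_mul]
            split_ifs
            · exact edgeMass_nonneg hl.nonneg _
            · exact le_rfl
  have htel : 1 - totalPathMass G T x s =
      ∑ k ∈ Finset.range s, (totalPathMass G T x k - totalPathMass G T x (k + 1)) := by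
    rw [Finset.sum_range_sub' (fun k => totalPathMass G T x k), totalPathMass_zero]
  rw [htel]
  refine (Finset.sum_le_sum fun k hk => hstep k (Finset.mem_range.1 hk)).trans (le_of_eq ?_)
  rw [← Finset.sum_fiberwise_of_maps_to (t := Finset.range s) (g := fun e : V × V => dep e.1)]
  · refine Finset.sum_congr rfl fun k _ => Finset.sum_congr ?_ fun _ _ => rfl
    rw [Finset.filter_filter]
  · intro e he
    have := hl.depth e (Finset.mem_filter.1 he).2.1
    exact Finset.mem_range.2 (by omega)

variable [LinearOrder V]

/-- If all out-degrees lie in `[a, b]`, the mass lost by the greedy tree is controlled by the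
excess edges of the breadth-first exploration. -/
theorem IsGreedyTree.one_sub_totalPathMass_le {a b : ℝ} (ha : 1 ≤ a)
    (hdeg : ∀ v, a ≤ (outDegree G v : ℝ) ∧ (outDegree G v : ℝ) ≤ b)
    (hθ : θ ≤ (b ^ s)⁻¹) (hT : IsGreedyTree G x s θ T) :
    1 - totalPathMass G T x s ≤
      ∑ j ∈ Finset.range s, (excessAt G x j).card * (a ^ (j + 1))⁻¹ := by
  classical
  obtain ⟨E, hrun, hdone⟩ := hT
  obtain ⟨dep, ms, hl⟩ := hrun.exists_isLabelling
  have ha0 : 0 < a := by linarith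
  have hab : a ≤ b := (hdeg x).1.trans (hdeg x).2
  have hb0 : 0 < b := by linarith
  have hTG : T ⊆ ChungLu.edges G := hl.subset.trans hl.edges
  -- The last clause says that tree depth dominates graph distance; the exploration is not
  -- breadth-first, so they may differ.
  have hms : ∀ v ∈ verts x E, (b ^ dep v)⁻¹ ≤ ms v ∧ ms v ≤ (a ^ dep v)⁻¹ ∧
      v ∈ ball G x (dep v) := by
    intro v hv
    obtain ⟨k, p, hp⟩ := exists_isPath_of_mem_verts hrun hv
    obtain ⟨rfl, h2⟩ := hl.of_isPath hp
    rw [← h2]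
    have h3 := pathMass_bounds ha hdeg (hp.mono hTG)
    exact ⟨h3.1, h3.2, hp.mem_ball hTG⟩
  have hE1 : ∀ f ∈ E, f.1 ∈ verts x E := fun f hf => Or.inr ⟨f, hf, Or.inl rfl⟩
  have hfull : ∀ e ∈ ChungLu.edges G, e.1 ∈ verts x E → dep e.1 + 1 ≤ s → e ∈ E := by
    intro e he hv hd
    refine hl.mem_of_stopped hrun hdone (fun f hf hdf => hθ.trans ?_) he hv hd
    -- An admissible edge has mass at least `b ^ (-(dep + 1))`, hence at least `b ^ (-s)`: the
    -- threshold is inactive.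
    have h1 : (b ^ dep f.1)⁻¹ * b⁻¹ ≤ edgeMass G ms f := by
      rw [edgeMass, one_div]
      refine mul_le_mul (hms _ hf.2.1).1 ?_ (by positivity) (hl.nonneg _)
      exact inv_anti₀ (lt_of_lt_of_le ha0 (hdeg _).1) (hdeg _).2
    refine le_trans ?_ h1
    rw [← mul_inv, ← pow_succ]
    exact inv_anti₀ (by positivity) (pow_le_pow_right₀ (by linarith) hdf)
  have hdeg0 : ∀ v, 0 < outDegree G v := fun v => by
    have := lt_of_lt_of_le ha0 (hdeg v).1
    exact_mod_cast this
  refine (hl.one_sub_totalPathMass_le hrun hdeg0 hfull).trans ?_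
  -- Masses are bounded through the distance `j` of the tail, which is at most its tree depth, to
  -- match the levels of `excessAt`.
  have hub : ∀ e ∈ E, ∃ j < s, e.1 ∈ sphere G x j ∧ edgeMass G ms e ≤ (a ^ (j + 1))⁻¹ := by
    intro e he
    have hv := hE1 e he
    obtain ⟨j, hj, hsj⟩ := exists_mem_sphere (hms _ hv).2.2
    have hd := hl.depth e he
    refine ⟨j, by omega, hsj, ?_⟩
    calc edgeMass G ms e ≤ (a ^ dep e.1)⁻¹ * a⁻¹ := by
          rw [edgeMass, one_div]
          refine mul_le_mul (hms _ hv).2.1 (inv_anti₀ ha0 (hdeg _).1) (by positivity)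
            (by positivity)
      _ = (a ^ (dep e.1 + 1))⁻¹ := by rw [← mul_inv, ← pow_succ]
      _ ≤ _ := inv_anti₀ (by positivity) (pow_le_pow_right₀ ha (by omega))
  -- `f` is the excess edge charged for the discarded edge `e`: either `e` itself, or the kept edge
  -- into the same head. The final disjunction is what makes the charging injective.
  have hcharge : ∀ e : V × V, e ∈ E ∧ e ∉ T → ∃ (j : ℕ) (f : V × V), j < s ∧
      f ∈ excessAt G x j ∧ edgeMass G ms e ≤ (a ^ (j + 1))⁻¹ ∧ f.2 = e.2 ∧
      (f = e ∨ (f ∈ T ∧ ∃ i, e.1 ∈ sphere G x i ∧ e ∉ excessAt G x i)) := by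
    rintro e ⟨heE, heT⟩
    obtain ⟨j, hj, hsj, hm⟩ := hub e heE
    by_cases hx : e ∈ excessAt G x j
    · exact ⟨j, e, hj, hx, hm, rfl, Or.inl rfl⟩
    · have hsp := snd_mem_sphere_of_notMem_excessAt (hl.edges heE) hsj hx
      rcases hl.kept e heE with h | ⟨t, ht, hte, hmt⟩
      -- A non-excess edge cannot return to the root, which lies in every ball.
      · rw [h, mem_sphere] at hsp
        exact absurd (ball_mono (Nat.zero_le j) (by simp [ball])) hsp.2
      · obtain ⟨i, hi, hsi, hmi⟩ := hub t (hl.subset ht)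
        refine ⟨i, t, hi, ?_, hmt.trans hmi, hte, Or.inr ⟨ht, j, hsj, hx⟩⟩
        by_contra hxt
        have := eq_of_notMem_excessAt (hTG ht) (hl.edges heE) hsi hsj hxt hx hte
        exact heT (this ▸ ht)
  choose! J F hJ hF hm hF2 hcase using hcharge
  set D := (Finset.univ : Finset (V × V)).filter (fun e => e ∈ E ∧ e ∉ T) with hD
  have hDm : ∀ e ∈ D, e ∈ E ∧ e ∉ T := fun e he => (Finset.mem_filter.1 he).2
  let ψ : V × V → (_ : ℕ) × (V × V) := fun e => ⟨J e, F e⟩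
  have hinj : Set.InjOn ψ D := by
    intro e he f hf hef
    have he' := hDm e he
    have hf' := hDm f hf
    have hFF : F e = F f := eq_of_heq (Sigma.mk.inj_iff.1 hef).2
    have h2 : e.2 = f.2 := by rw [← hF2 e he', ← hF2 f hf', hFF]
    -- Mixed cases would put a discarded edge into `T`; when both are charged to kept edges, two
    -- non-excess edges share a head.
    rcases hcase e he' with h | ⟨h, i, hi, hix⟩ <;> rcases hcase f hf' with h' | ⟨h', i', hi', hix'⟩
    · rw [← h, ← h', hFF]
    · exact absurd (h ▸ hFF ▸ h') he'.2
    · exact absurd (h' ▸ hFF ▸ h) hf'.2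
    · exact eq_of_notMem_excessAt (hl.edges he'.1) (hl.edges hf'.1) hi hi' hix hix' h2
  calc ∑ e ∈ D, edgeMass G ms e ≤ ∑ e ∈ D, (a ^ ((ψ e).1 + 1))⁻¹ :=
        Finset.sum_le_sum fun e he => hm e (hDm e he)
    _ = ∑ q ∈ D.image ψ, (a ^ (q.1 + 1))⁻¹ := (Finset.sum_image (f := fun q : (_ : ℕ) × (V × V) =>
        (a ^ (q.1 + 1))⁻¹) hinj).symm
    _ ≤ ∑ q ∈ (Finset.range s).sigma (fun j => excessAt G x j), (a ^ (q.1 + 1))⁻¹ := by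
        refine Finset.sum_le_sum_of_subset_of_nonneg ?_ fun _ _ _ => by positivity
        intro q hq
        obtain ⟨e, he, rfl⟩ := Finset.mem_image.1 hq
        exact Finset.mem_sigma.2 ⟨Finset.mem_range.2 (hJ e (hDm e he)), hF e (hDm e he)⟩
    _ = _ := by
        rw [Finset.sum_sigma]
        simp

end Mass

/-! ### Independence and exponential moments -/

section Probability

variable {n : ℕ} {wOut wIn : Fin n → ℝ}

instance isProbabilityMeasure_graphLaw : IsProbabilityMeasure (graphLaw wOut wIn) := by
  unfold graphLaw
  infer_instance

theorem integrable_graphLaw (f : EdgeConfig n → ℝ) : Integrable f (graphLaw wOut wIn) :=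
  Integrable.of_finite

/-- Functions depending on disjoint sets of edges are uncorrelated. -/
theorem integral_mul_of_dependsOn {f g : EdgeConfig n → ℝ} {S S' : Finset (Fin n × Fin n)}
    (hS : Disjoint S S') (hf : DependsOn f S) (hg : DependsOn g S') :
    ∫ ω, f ω * g ω ∂(graphLaw wOut wIn) =
      (∫ ω, f ω ∂(graphLaw wOut wIn)) * ∫ ω, g ω ∂(graphLaw wOut wIn) := by
  classical
  have hind : iIndepFun (fun (e : Fin n × Fin n) (ω : EdgeConfig n) => ω e)
      (graphLaw wOut wIn) :=
    iIndepFun_pi (X := fun _ b => b) fun _ => aemeasurable_id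
  have hpair := hind.indepFun_finset S S' hS fun e => measurable_pi_apply e
  -- Partial configurations are completed by `false`; the value is irrelevant, as `f` and `g` ignore
  -- those coordinates.
  let ext (R : Finset (Fin n × Fin n)) (r : R → Bool) : EdgeConfig n :=
    fun e => if h : e ∈ R then r ⟨e, h⟩ else false
  have hfe : ∀ ω, f ω = f (ext S fun i => ω i) := fun ω => hf fun e he => by
    have : e ∈ S := he
    simp [ext, this]
  have hge : ∀ ω, g ω = g (ext S' fun i => ω i) := fun ω => hg fun e he => by
    have : e ∈ S' := he
    simp [ext, this]
  have hcomp := hpair.comp (φ := fun r => f (ext S r)) (ψ := fun r => g (ext S' r))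
    (measurable_of_finite _) (measurable_of_finite _)
  have := hcomp.integral_fun_mul_eq_mul_integral
    (measurable_of_finite _).aestronglyMeasurable (measurable_of_finite _).aestronglyMeasurable
  simp only [Function.comp_def, ← hfe, ← hge] at this
  exact this

/-- Decoupling: if `g a` is independent of the event `Z = a` and of `f` on it, then the mean of
`f * g Z` is bounded by means of the `g a`. -/
theorem integral_mul_comp_le {α : Type*} [Fintype α] [DecidableEq α] {Z : EdgeConfig n → α}
    {f : EdgeConfig n → ℝ} {g : α → EdgeConfig n → ℝ} {S S' : α → Finset (Fin n × Fin n)} {c : ℝ}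
    (hf : ∀ ω, 0 ≤ f ω) (hS : ∀ a, Disjoint (S a) (S' a))
    (hfS : ∀ a, DependsOn (fun ω => if Z ω = a then f ω else 0) (S a : Set (Fin n × Fin n)))
    (hgS : ∀ a, DependsOn (g a) (S' a : Set (Fin n × Fin n)))
    (hc : ∀ ω, f ω ≠ 0 → ∫ ω', g (Z ω) ω' ∂(graphLaw wOut wIn) ≤ c) :
    ∫ ω, f ω * g (Z ω) ω ∂(graphLaw wOut wIn) ≤ c * ∫ ω, f ω ∂(graphLaw wOut wIn) := by
  have h1 : ∀ ω, f ω * g (Z ω) ω = ∑ a, (if Z ω = a then f ω else 0) * g a ω := by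
    intro ω
    simp
  have h2 : ∀ ω, f ω = ∑ a, (if Z ω = a then f ω else 0) := by
    intro ω
    simp
  simp_rw [h1]
  rw [integral_finsetSum _ fun _ _ => integrable_graphLaw _]
  have h3 : ∫ ω, f ω ∂(graphLaw wOut wIn) =
      ∑ a, ∫ ω, (if Z ω = a then f ω else 0) ∂(graphLaw wOut wIn) := by
    rw [← integral_finsetSum _ fun _ _ => integrable_graphLaw _]
    simp_rw [← h2]
  rw [h3, Finset.mul_sum]
  refine Finset.sum_le_sum fun a _ => ?_
  rw [integral_mul_of_dependsOn (hS a) (hfS a) (hgS a), mul_comm c]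
  -- The bound on `g a` is available only for values taken where `f ≠ 0`; all other terms vanish.
  by_cases ha : ∃ ω, Z ω = a ∧ f ω ≠ 0
  · obtain ⟨ω, rfl, hω⟩ := ha
    refine mul_le_mul_of_nonneg_left (hc ω hω) (integral_nonneg fun ω => ?_)
    simp only [Pi.zero_apply]
    split_ifs
    · exact hf _
    · exact le_rfl
  · push Not at ha
    have h0 : (fun ω => if Z ω = a then f ω else 0) = fun _ => (0 : ℝ) := by
      funext ω
      split_ifs with h
      · exact ha ω h
      · rfl
    rw [h0]
    simp

theorem mem_outNbrs_toDigraph {ω : EdgeConfig n} {u w : Fin n} :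
    w ∈ outNbrs (toDigraph ω) u ↔ ω (u, w) = true := mem_outNbrs

/-- Exponential moment of the number of out-neighbours of `u` in `W`. -/
theorem integral_exp_card_outNbrs_le (t : ℝ) (u : Fin n) (W : Finset (Fin n)) :
    ∫ ω, Real.exp (t * (outNbrs (toDigraph ω) u ∩ W).card) ∂(graphLaw wOut wIn) ≤
      Real.exp ((Real.exp t - 1) * ∑ w ∈ W, (edgeProb wOut wIn u w : ℝ)) := by
  let F : Fin n × Fin n → Bool → ℝ := fun e b =>
    if e.1 = u ∧ e.2 ∈ W ∧ b = true then Real.exp t else 1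
  have h1 : ∀ ω : EdgeConfig n, Real.exp (t * (outNbrs (toDigraph ω) u ∩ W).card) =
      ∏ e, F e (ω e) := by
    intro ω
    rw [← Finset.univ_product_univ, Finset.prod_product, Finset.prod_eq_single u]
    · have h2 : ∀ w, F (u, w) (ω (u, w)) =
          if w ∈ outNbrs (toDigraph ω) u ∩ W then Real.exp t else 1 := by
        intro w
        simp only [F, true_and, Finset.mem_inter, mem_outNbrs_toDigraph]
        exact if_congr and_comm rfl rfl
      simp_rw [h2]
      rw [Finset.prod_ite_mem, Finset.univ_inter, Finset.prod_const, ← Real.exp_nat_mul, mul_comm]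
    · intro v _ hv
      refine Finset.prod_eq_one fun w _ => ?_
      simp [F, hv]
    · simp
  simp_rw [h1]
  rw [graphLaw, integral_fintype_prod_eq_prod]
  have h3 : ∀ e : Fin n × Fin n,
      ∫ b, F e b ∂(bernoulliMeasure true false (edgeProb wOut wIn e.1 e.2)) ≤
        Real.exp (if e.1 = u ∧ e.2 ∈ W then
          (Real.exp t - 1) * (edgeProb wOut wIn e.1 e.2 : ℝ) else 0) := by
    intro e
    rw [integral_bernoulliMeasure]
    simp only [F, smul_eq_mul, Bool.false_eq_true, and_false, and_true, if_false]
    split_ifs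
    -- The Bernoulli moment is `1 + (exp t - 1) p`, whatever the sign of `t`; the lower tail of the
    -- degrees uses negative `t`.
    · refine le_trans (le_of_eq ?_) (Real.add_one_le_exp _)
      ring
    · simp
  have h4 : ∀ e : Fin n × Fin n,
      0 ≤ ∫ b, F e b ∂(bernoulliMeasure true false (edgeProb wOut wIn e.1 e.2)) := by
    intro e
    refine integral_nonneg fun b => ?_
    simp only [F, Pi.zero_apply]
    split_ifs <;> positivity
  refine (Finset.prod_le_prod (fun e _ => h4 e) fun e _ => h3 e).trans (le_of_eq ?_)
  rw [← Real.exp_sum, ← Finset.univ_product_univ, Finset.sum_product, Finset.sum_eq_single u]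
  · congr 1
    rw [Finset.mul_sum, ← Finset.sum_filter]
    refine Finset.sum_congr ?_ fun _ _ => rfl
    ext w
    simp
  · intro v _ hv
    refine Finset.sum_eq_zero fun w _ => ?_
    simp [hv]
  · simp

/-- The possible edges with tail in `L`. -/
def rows (L : Finset (Fin n)) : Finset (Fin n × Fin n) := L ×ˢ Finset.univ

theorem mem_rows {L : Finset (Fin n)} {e : Fin n × Fin n} : e ∈ rows L ↔ e.1 ∈ L := by
  simp [rows]

/-! ### Revealing the graph row by row. -/

theorem outNbrs_congr {ω ω' : EdgeConfig n} {L : Finset (Fin n)}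
    (h : ∀ e ∈ (rows L : Set (Fin n × Fin n)), ω e = ω' e) {u : Fin n} (hu : u ∈ L) :
    outNbrs (toDigraph ω) u = outNbrs (toDigraph ω') u := by
  ext w
  have h1 : (u, w) ∈ (rows L : Set (Fin n × Fin n)) := Finset.mem_coe.2 (mem_rows.2 hu)
  rw [mem_outNbrs_toDigraph, mem_outNbrs_toDigraph, h _ h1]

theorem outNbhd_congr {ω ω' : EdgeConfig n} {L : Finset (Fin n)}
    (h : ∀ e ∈ (rows L : Set (Fin n × Fin n)), ω e = ω' e) :
    outNbhd (toDigraph ω) L = outNbhd (toDigraph ω') L :=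
  Finset.biUnion_congr rfl fun _ hu => outNbrs_congr h hu

theorem excess_congr {ω ω' : EdgeConfig n} {L : Finset (Fin n)} (B : Finset (Fin n))
    (h : ∀ e ∈ (rows L : Set (Fin n × Fin n)), ω e = ω' e) :
    excess (toDigraph ω) L B = excess (toDigraph ω') L B := by
  have hadj : ∀ u ∈ L, ∀ w, (toDigraph ω).Adj u w ↔ (toDigraph ω').Adj u w := by
    intro u hu w
    rw [← mem_outNbrs, ← mem_outNbrs, outNbrs_congr h hu]
  ext e
  rw [mem_excess, mem_excess]
  refine and_congr_right fun he => and_congr (hadj _ he _) (or_congr Iff.rfl ?_)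
  exact exists_congr fun u => and_congr_right fun hu => and_congr_right fun _ => hadj u hu _

/-- Excess is decided by smaller tails only, so a new largest tail `u` leaves the excess edges of
`L` unchanged and adds those from `u` into already discovered vertices. -/
theorem card_excess_insert_le {G : Digraph (Fin n)} {L B : Finset (Fin n)} {u : Fin n}
    (hu : ∀ v ∈ L, v < u) :
    (excess G (insert u L) B).card ≤
      (excess G L B).card + (outNbrs G u ∩ (B ∪ outNbhd G L)).card := by
  have hsub : excess G (insert u L) B ⊆
      excess G L B ∪ {u} ×ˢ (outNbrs G u ∩ (B ∪ outNbhd G L)) := by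
    intro e he
    obtain ⟨h1, h2, h3⟩ := mem_excess.1 he
    rw [Finset.mem_union]
    rcases Finset.mem_insert.1 h1 with hm | hm
    · right
      rw [Finset.mem_product, Finset.mem_singleton, Finset.mem_inter, mem_outNbrs,
        Finset.mem_union, mem_outNbhd]
      refine ⟨hm, hm ▸ h2, ?_⟩
      rcases h3 with h3 | ⟨v, hv, hlt, hadj⟩
      · exact Or.inl h3
      · rcases Finset.mem_insert.1 hv with rfl | hv
        · exact absurd (hm ▸ hlt) (lt_irrefl _)
        · exact Or.inr ⟨v, hv, hadj⟩
    · left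
      refine mem_excess.2 ⟨hm, h2, ?_⟩
      rcases h3 with h3 | ⟨v, hv, hlt, hadj⟩
      · exact Or.inl h3
      · rcases Finset.mem_insert.1 hv with rfl | hv
        · exact absurd (hlt.trans (hu _ hm)) (lt_irrefl _)
        · exact Or.inr ⟨v, hv, hlt, hadj⟩
  refine (Finset.card_le_card hsub).trans ((Finset.card_union_le _ _).trans ?_)
  rw [Finset.card_product, Finset.card_singleton, one_mul]

open Classical in
/-- Exponential moment of the number of excess edges with tail in `L`, as long as few vertices are
discovered. -/
theorem integral_exp_card_excess_le {K q t : ℝ} (ht : 0 ≤ t)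
    (hq : ∀ (u : Fin n) (W : Finset (Fin n)), (W.card : ℝ) ≤ K →
      ∑ w ∈ W, (edgeProb wOut wIn u w : ℝ) ≤ q) (L B : Finset (Fin n)) :
    ∫ ω, (if ((B ∪ outNbhd (toDigraph ω) L).card : ℝ) ≤ K then
        Real.exp (t * (excess (toDigraph ω) L B).card) else 0) ∂(graphLaw wOut wIn) ≤
      Real.exp ((Real.exp t - 1) * (L.card * q)) := by
  have ht1 : 0 ≤ Real.exp t - 1 := by linarith [Real.add_one_le_exp t]
  induction L using Finset.induction_on_max with
  | empty =>
    have h0 : ∀ ω : EdgeConfig n, (if ((B ∪ outNbhd (toDigraph ω) ∅).card : ℝ) ≤ K then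
        Real.exp (t * (excess (toDigraph ω) ∅ B).card) else 0) ≤ 1 := by
      intro ω
      have h1 : excess (toDigraph ω) ∅ B = ∅ := by
        ext e
        simp [mem_excess]
      rw [h1]
      split_ifs <;> simp
    refine (integral_mono (integrable_graphLaw _) (integrable_graphLaw _) h0).trans ?_
    simp
  | insert u L hu ih =>
    have huL : u ∉ L := fun h => lt_irrefl _ (hu u h)
    set f : EdgeConfig n → ℝ := fun ω => if ((B ∪ outNbhd (toDigraph ω) L).card : ℝ) ≤ K then
        Real.exp (t * (excess (toDigraph ω) L B).card) else 0 with hf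
    have hf0 : ∀ ω, 0 ≤ f ω := fun ω => by
      simp only [hf]
      split_ifs <;> positivity
    -- The discovered set grows with `L`, so the cutoff at `K` passes down to `L` and the induction
    -- closes.
    have hle : ∀ ω : EdgeConfig n,
        (if ((B ∪ outNbhd (toDigraph ω) (insert u L)).card : ℝ) ≤ K then
          Real.exp (t * (excess (toDigraph ω) (insert u L) B).card) else 0) ≤
        f ω * Real.exp (t *
          (outNbrs (toDigraph ω) u ∩ (B ∪ outNbhd (toDigraph ω) L)).card) := by
      intro ω
      split_ifs with h
      · have hsub : B ∪ outNbhd (toDigraph ω) L ⊆ B ∪ outNbhd (toDigraph ω) (insert u L) :=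
          Finset.union_subset_union_right
            (Finset.biUnion_subset_biUnion_of_subset_left _ (Finset.subset_insert _ _))
        have h1 : ((B ∪ outNbhd (toDigraph ω) L).card : ℝ) ≤ K :=
          le_trans (by exact_mod_cast Finset.card_le_card hsub) h
        simp only [hf]
        rw [if_pos h1, ← Real.exp_add, ← mul_add]
        refine Real.exp_le_exp.2 (mul_le_mul_of_nonneg_left ?_ ht)
        exact_mod_cast card_excess_insert_le hu
      · exact mul_nonneg (hf0 ω) (Real.exp_nonneg _)
    refine (integral_mono (integrable_graphLaw _) (integrable_graphLaw _) hle).trans ?_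
    -- The row of `u` is independent of the rows of `L`, which determine the discovered set; each
    -- tail thus costs a factor `exp((exp t - 1) q)`.
    have hdec := integral_mul_comp_le (wOut := wOut) (wIn := wIn)
      (Z := fun ω => B ∪ outNbhd (toDigraph ω) L) (f := f)
      (g := fun W ω => Real.exp (t * (outNbrs (toDigraph ω) u ∩ W).card))
      (S := fun _ => rows L) (S' := fun _ => rows {u}) (c := Real.exp ((Real.exp t - 1) * q)) hf0
      ?_ ?_ ?_ ?_
    · refine hdec.trans ?_
      rw [Finset.card_insert_of_notMem huL]
      calc _ ≤ Real.exp ((Real.exp t - 1) * q) * Real.exp ((Real.exp t - 1) * (L.card * q)) :=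
            mul_le_mul_of_nonneg_left ih (Real.exp_nonneg _)
        _ = _ := by
            rw [← Real.exp_add]
            push_cast
            ring_nf
    · intro _
      rw [Finset.disjoint_left]
      intro e h1 h2
      rw [mem_rows] at h1 h2
      exact huL (Finset.mem_singleton.1 h2 ▸ h1)
    · intro W ω ω' h
      simp only [hf, outNbhd_congr h, excess_congr B h]
    · intro W ω ω' h
      simp only [outNbrs_congr h (Finset.mem_singleton_self u)]
    · intro ω hω
      have h1 : ((B ∪ outNbhd (toDigraph ω) L).card : ℝ) ≤ K := by
        by_contra h
        exact hω (if_neg h)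
      refine (integral_exp_card_outNbrs_le t u _).trans ?_
      exact Real.exp_le_exp.2 (mul_le_mul_of_nonneg_left (hq u _ h1) ht1)

/-- The breadth-first exploration has a stopping property: the event that the inner ball equals `A`
is decided by the rows of `A`, leaving the rows of the sphere fresh. -/
theorem ball_congr {ω ω' : EdgeConfig n} (x : Fin n) (j : ℕ)
    (h : ∀ e ∈ (rows (innerBall (toDigraph ω) x j) : Set (Fin n × Fin n)), ω e = ω' e) :
    innerBall (toDigraph ω) x j = innerBall (toDigraph ω') x j ∧
      ball (toDigraph ω) x j = ball (toDigraph ω') x j := by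
  induction j with
  | zero => exact ⟨rfl, rfl⟩
  | succ j ih =>
    have h1 : ball (toDigraph ω) x j = ball (toDigraph ω') x j := by
      refine (ih fun e he => h e ?_).2
      exact Finset.mem_coe.2 (mem_rows.2 (innerBall_subset j (mem_rows.1 (Finset.mem_coe.1 he))))
    refine ⟨h1, ?_⟩
    have h2 := outNbhd_congr h
    simp only [innerBall] at h2
    simp only [ball]
    rw [h2, h1]

/-- Tail bound for the number of excess edges at distance `j` from `x`. -/
theorem measureReal_excessAt_le {K q t R : ℝ} (ht : 0 ≤ t) (hq0 : 0 ≤ q)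
    (hq : ∀ (u : Fin n) (W : Finset (Fin n)), (W.card : ℝ) ≤ K →
      ∑ w ∈ W, (edgeProb wOut wIn u w : ℝ) ≤ q) (x : Fin n) (j : ℕ) :
    (graphLaw wOut wIn).real {ω | ((ball (toDigraph ω) x (j + 1)).card : ℝ) ≤ K ∧
      R ≤ ((excessAt (toDigraph ω) x j).card : ℝ)} ≤
      Real.exp ((Real.exp t - 1) * (K * q) - t * R) := by
  classical
  have ht1 : 0 ≤ Real.exp t - 1 := by linarith [Real.add_one_le_exp t]
  set Z : EdgeConfig n → Finset (Fin n) × Finset (Fin n) :=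
    fun ω => (innerBall (toDigraph ω) x j, ball (toDigraph ω) x j) with hZ
  set g : Finset (Fin n) × Finset (Fin n) → EdgeConfig n → ℝ := fun a ω =>
    if ((a.2 ∪ outNbhd (toDigraph ω) (a.2 \ a.1)).card : ℝ) ≤ K then
      Real.exp (t * (excess (toDigraph ω) (a.2 \ a.1) a.2).card) else 0 with hg
  have hg0 : ∀ a ω, 0 ≤ g a ω := fun a ω => by
    simp only [hg]
    split_ifs <;> positivity
  have hdec := integral_mul_comp_le (wOut := wOut) (wIn := wIn)
    (Z := Z) (f := fun _ => 1) (g := g) (S := fun a => rows a.1) (S' := fun a => rows (a.2 \ a.1))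
    (c := Real.exp ((Real.exp t - 1) * (K * q))) (fun _ => zero_le_one) ?_ ?_ ?_ ?_
  · simp only [one_mul, integral_const, probReal_univ, smul_eq_mul, mul_one] at hdec
    set A := {ω | ((ball (toDigraph ω) x (j + 1)).card : ℝ) ≤ K ∧
      R ≤ ((excessAt (toDigraph ω) x j).card : ℝ)} with hA
    have hind : ∀ ω, A.indicator (fun _ => (1 : ℝ)) ω ≤ Real.exp (-(t * R)) * g (Z ω) ω := by
      intro ω
      by_cases hω : ω ∈ A
      · rw [Set.indicator_of_mem hω]
        have h1 : ((ball (toDigraph ω) x j ∪ outNbhd (toDigraph ω) (ball (toDigraph ω) x j \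
            innerBall (toDigraph ω) x j)).card : ℝ) ≤ K := by
          refine le_trans ?_ hω.1
          have hsub : ball (toDigraph ω) x j ∪ outNbhd (toDigraph ω) (ball (toDigraph ω) x j \
            innerBall (toDigraph ω) x j) ⊆ ball (toDigraph ω) x (j + 1) :=
            Finset.union_subset_union_right
              (Finset.biUnion_subset_biUnion_of_subset_left _ Finset.sdiff_subset)
          exact_mod_cast Finset.card_le_card hsub
        simp only [hg, hZ]
        rw [if_pos h1, ← Real.exp_add, Real.one_le_exp_iff]
        have h2 := mul_le_mul_of_nonneg_left hω.2 ht
        simp only [excessAt, sphere] at h2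
        linarith
      · rw [Set.indicator_of_notMem hω]
        exact mul_nonneg (Real.exp_nonneg _) (hg0 _ _)
    have hreal : (graphLaw wOut wIn).real A =
        ∫ ω, A.indicator (fun _ => (1 : ℝ)) ω ∂(graphLaw wOut wIn) := by
      rw [integral_indicator_const _ (Set.toFinite A).measurableSet]
      simp
    rw [hreal]
    refine (integral_mono (integrable_graphLaw _) (integrable_graphLaw _) hind).trans ?_
    rw [integral_const_mul, sub_eq_neg_add, Real.exp_add]
    exact mul_le_mul_of_nonneg_left hdec (Real.exp_nonneg _)
  · intro a
    rw [Finset.disjoint_left]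
    intro e h1 h2
    rw [mem_rows] at h1 h2
    exact (Finset.mem_sdiff.1 h2).2 h1
  · rintro ⟨A, B⟩ ω ω' h
    have key : ∀ ω ω' : EdgeConfig n,
        (∀ e ∈ (rows A : Set (Fin n × Fin n)), ω e = ω' e) → Z ω = (A, B) → Z ω' = (A, B) := by
      intro ω ω' h hω
      have h1 : innerBall (toDigraph ω) x j = A := congrArg Prod.fst hω
      rw [← h1] at h
      obtain ⟨h2, h3⟩ := ball_congr x j h
      rw [← hω]
      simp only [hZ]
      rw [h2, h3]
    exact if_congr ⟨key ω ω' h, key ω' ω fun e he => (h e he).symm⟩ rfl rfl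
  · rintro ⟨A, B⟩ ω ω' h
    simp only [hg, outNbhd_congr h, excess_congr B h]
  · intro ω _
    -- A sphere lies in its ball, so it has at most `K` tails; if the ball is already too large, the
    -- cutoff kills `g`.
    by_cases hB : ((Z ω).2.card : ℝ) ≤ K
    · refine (integral_exp_card_excess_le ht hq _ _).trans (Real.exp_le_exp.2 ?_)
      refine mul_le_mul_of_nonneg_left (mul_le_mul_of_nonneg_right (le_trans ?_ hB) hq0) ht1
      exact_mod_cast Finset.card_le_card Finset.sdiff_subset
    · have h0 : ∀ ω', g (Z ω) ω' = 0 := by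
        intro ω'
        simp only [hg]
        refine if_neg fun h => hB (le_trans ?_ h)
        exact_mod_cast Finset.card_le_card Finset.subset_union_left
      simp_rw [h0]
      simp [Real.exp_nonneg]

end Probability

/-! ### Degrees, entropy and the bad event -/

section Estimates

variable {n : ℕ} {wOut wIn : Fin n → ℝ} {M₀ M₁ M₂ : ℝ}

/-- Bounds on the weights: out-weights in `[M₀, M₁]`, second moment of the in-weights at most
`M₂ n`. -/
structure WeightBounds (wOut wIn : Fin n → ℝ) (M₀ M₁ M₂ : ℝ) : Prop where
  one_lt : 1 < M₀
  out_ge : ∀ x, M₀ ≤ wOut x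
  out_le : ∀ x, wOut x ≤ M₁
  in_pos : ∀ x, 0 < wIn x
  sum_eq : ∑ x, wOut x = ∑ x, wIn x
  sq_sum : ∑ x, wIn x ^ 2 ≤ M₂ * n

/-! ### Edge probabilities and tails of the out-degrees. -/

theorem edgeProb_le (h : WeightBounds wOut wIn M₀ M₁ M₂) (u w : Fin n) :
    (edgeProb wOut wIn u w : ℝ) ≤ M₁ * (Real.log n / n) * wIn w := by
  have hl : 0 ≤ Real.log n / n := div_nonneg (Real.log_natCast_nonneg n) (Nat.cast_nonneg n)
  have h0 : 0 ≤ wOut u := by linarith [h.one_lt, h.out_ge u]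
  have h2 : wOut u * wIn w * (Real.log n / n) ≤ M₁ * (Real.log n / n) * wIn w := by
    have := mul_le_mul_of_nonneg_right (h.out_le u) (mul_nonneg (h.in_pos w).le hl)
    linarith
  have h1 : 0 ≤ wOut u * wIn w * (Real.log n / n) :=
    mul_nonneg (mul_nonneg h0 (h.in_pos w).le) hl
  unfold edgeProb
  split_ifs
  · exact le_trans (by simpa using h1) h2
  · rw [Set.coe_projIcc]
    exact (max_le h1 (min_le_right _ _)).trans h2

/-- Cauchy–Schwarz against the second moment: even the heaviest `K` vertices carry in-weight at most
`√(K M₂ n)`. -/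
theorem sum_edgeProb_le_sqrt (h : WeightBounds wOut wIn M₀ M₁ M₂) {K : ℝ} (u : Fin n)
    (W : Finset (Fin n)) (hW : (W.card : ℝ) ≤ K) :
    ∑ w ∈ W, (edgeProb wOut wIn u w : ℝ) ≤ M₁ * Real.log n * √(K * M₂ / n) := by
  have hn : (0 : ℝ) < n := by exact_mod_cast u.pos
  have hM₁ : 0 ≤ M₁ := by linarith [h.one_lt, h.out_ge u, h.out_le u]
  have hl : 0 ≤ Real.log n := Real.log_natCast_nonneg n
  have h1 : (∑ w ∈ W, wIn w) ^ 2 ≤ K * (M₂ * n) := by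
    refine (sq_sum_le_card_mul_sum_sq (s := W) (f := wIn)).trans ?_
    have h2 : ∑ w ∈ W, wIn w ^ 2 ≤ M₂ * n :=
      (Finset.sum_le_univ_sum_of_nonneg fun w => sq_nonneg _).trans h.sq_sum
    exact mul_le_mul hW h2 (Finset.sum_nonneg fun w _ => sq_nonneg _)
      ((Nat.cast_nonneg _).trans hW)
  have h3 : ∑ w ∈ W, wIn w ≤ √(K * M₂ / n) * n := by
    have h4 : √(K * M₂ / n) * n = √(K * (M₂ * n)) := by
      have h5 : K * (M₂ * n) = K * M₂ / n * n ^ 2 := by field_simp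
      rw [h5, Real.sqrt_mul' _ (by positivity), Real.sqrt_sq hn.le]
    rw [h4]
    exact Real.le_sqrt_of_sq_le h1
  calc ∑ w ∈ W, (edgeProb wOut wIn u w : ℝ) ≤ ∑ w ∈ W, M₁ * (Real.log n / n) * wIn w :=
        Finset.sum_le_sum fun w _ => edgeProb_le h u w
    _ = M₁ * (Real.log n / n) * ∑ w ∈ W, wIn w := by rw [Finset.mul_sum]
    _ ≤ M₁ * (Real.log n / n) * (√(K * M₂ / n) * n) := by gcongr
    _ = _ := by field_simp

theorem sum_edgeProb_le (h : WeightBounds wOut wIn M₀ M₁ M₂) (u : Fin n) :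
    ∑ w, (edgeProb wOut wIn u w : ℝ) ≤ M₁ ^ 2 * Real.log n := by
  have hn : (0 : ℝ) < n := by exact_mod_cast u.pos
  have hM₁ : 0 ≤ M₁ := by linarith [h.one_lt, h.out_ge u, h.out_le u]
  have hl : 0 ≤ Real.log n := Real.log_natCast_nonneg n
  have h1 : ∑ w, wIn w ≤ n * M₁ := by
    rw [← h.sum_eq]
    refine (Finset.sum_le_sum fun w _ => h.out_le w).trans ?_
    simp
  calc ∑ w, (edgeProb wOut wIn u w : ℝ) ≤ ∑ w, M₁ * (Real.log n / n) * wIn w :=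
        Finset.sum_le_sum fun w _ => edgeProb_le h u w
    _ = M₁ * (Real.log n / n) * ∑ w, wIn w := by rw [Finset.mul_sum]
    _ ≤ M₁ * (Real.log n / n) * (n * M₁) := by gcongr
    _ = _ := by field_simp

theorem in_le_sqrt (h : WeightBounds wOut wIn M₀ M₁ M₂) (u : Fin n) : wIn u ≤ √(M₂ * n) :=
  Real.le_sqrt_of_sq_le ((Finset.single_le_sum (f := fun w => wIn w ^ 2)
    (fun _ _ => sq_nonneg _) (Finset.mem_univ u)).trans h.sq_sum)

/-- No in-weight exceeds `√(M₂ n)`, so the truncation at one is inactive, and excluding the loop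
costs at most `(M₀ - 1) n` of a total in-weight at least `M₀ n`. -/
theorem le_sum_edgeProb (h : WeightBounds wOut wIn M₀ M₁ M₂)
    (h1 : M₁ * √(M₂ * n) * Real.log n ≤ n) (h2 : √(M₂ * n) ≤ (M₀ - 1) * n) (u : Fin n) :
    M₀ * Real.log n ≤ ∑ w, (edgeProb wOut wIn u w : ℝ) := by
  have hn : (0 : ℝ) < n := by exact_mod_cast u.pos
  have hM₀ := h.one_lt
  have hl : 0 ≤ Real.log n := Real.log_natCast_nonneg n
  have hp : ∀ w, (edgeProb wOut wIn u w : ℝ) =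
      wOut u * (Real.log n / n) * (wIn w - if w = u then wIn u else 0) := by
    intro w
    unfold edgeProb
    by_cases hw : u = w
    · simp [hw]
    · rw [if_neg hw, if_neg (Ne.symm hw), Set.coe_projIcc]
      have h3 : wOut u * wIn w * (Real.log n / n) ≤ 1 := by
        have h4 : wOut u * wIn w ≤ M₁ * √(M₂ * n) :=
          mul_le_mul (h.out_le u) (in_le_sqrt h w) (h.in_pos w).le
            (by linarith [h.out_ge u, h.out_le u])
        rw [← mul_div_assoc, div_le_one hn]
        exact (mul_le_mul_of_nonneg_right h4 hl).trans h1
      have h5 : 0 ≤ wOut u * wIn w * (Real.log n / n) :=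
        mul_nonneg (mul_nonneg (by linarith [h.out_ge u]) (h.in_pos w).le) (by positivity)
      rw [min_eq_right h3, max_eq_right h5]
      ring
  simp_rw [hp]
  rw [← Finset.mul_sum, Finset.sum_sub_distrib, Finset.sum_ite_eq' Finset.univ u,
    if_pos (Finset.mem_univ u), ← h.sum_eq]
  have h6 : n * M₀ ≤ ∑ x, wOut x := by
    refine le_trans (le_of_eq ?_) (Finset.sum_le_sum fun w _ => h.out_ge w)
    simp
  have h7 := in_le_sqrt h u
  calc M₀ * Real.log n = M₀ * (Real.log n / n) * n := by field_simp
    _ ≤ wOut u * (Real.log n / n) * (∑ x, wOut x - wIn u) := by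
        refine mul_le_mul ?_ (by linarith) hn.le ?_
        · exact mul_le_mul_of_nonneg_right (h.out_ge u) (by positivity)
        · exact mul_nonneg (by linarith [h.out_ge u]) (by positivity)

/-- Exponential Markov inequality. -/
theorem measureReal_le_integral_exp {A : Set (EdgeConfig n)} {X : EdgeConfig n → ℝ}
    (hA : ∀ ω ∈ A, 0 ≤ X ω) :
    (graphLaw wOut wIn).real A ≤ ∫ ω, Real.exp (X ω) ∂(graphLaw wOut wIn) := by
  have hreal : (graphLaw wOut wIn).real A =
      ∫ ω, A.indicator (fun _ => (1 : ℝ)) ω ∂(graphLaw wOut wIn) := by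
    rw [integral_indicator_const _ (Set.toFinite A).measurableSet]
    simp
  rw [hreal]
  refine integral_mono (integrable_graphLaw _) (integrable_graphLaw _) fun ω => ?_
  by_cases hω : ω ∈ A
  · rw [Set.indicator_of_mem hω]
    exact Real.one_le_exp (hA ω hω)
  · rw [Set.indicator_of_notMem hω]
    exact Real.exp_nonneg _

theorem integral_exp_outDegree_le (t : ℝ) (u : Fin n) :
    ∫ ω, Real.exp (t * outDegree (toDigraph ω) u) ∂(graphLaw wOut wIn) ≤
      Real.exp ((Real.exp t - 1) * ∑ w, (edgeProb wOut wIn u w : ℝ)) := by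
  have := integral_exp_card_outNbrs_le (wOut := wOut) (wIn := wIn) t u Finset.univ
  simp_rw [Finset.inter_univ, ← outDegree_eq_card] at this
  exact this

theorem measureReal_outDegree_gt_le (h : WeightBounds wOut wIn M₀ M₁ M₂) (u : Fin n) :
    (graphLaw wOut wIn).real
      {ω | (2 * M₁ ^ 2 + 3) * Real.log n < outDegree (toDigraph ω) u} ≤
        Real.exp (-(3 * Real.log n)) := by
  have hl : 0 ≤ Real.log n := Real.log_natCast_nonneg n
  refine (measureReal_le_integral_exp (X := fun ω =>
    -((2 * M₁ ^ 2 + 3) * Real.log n) + 1 * outDegree (toDigraph ω) u) fun ω hω => ?_).trans ?_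
  · have h1 : (2 * M₁ ^ 2 + 3) * Real.log n < outDegree (toDigraph ω) u := hω
    linarith
  · simp_rw [Real.exp_add]
    rw [integral_const_mul]
    refine (mul_le_mul_of_nonneg_left (integral_exp_outDegree_le 1 u)
      (Real.exp_nonneg _)).trans ?_
    rw [← Real.exp_add, Real.exp_le_exp]
    have h2 : Real.exp 1 - 1 ≤ 2 := by linarith [Real.exp_one_lt_d9]
    have h3 : 0 ≤ ∑ w, (edgeProb wOut wIn u w : ℝ) :=
      Finset.sum_nonneg fun w _ => (edgeProb wOut wIn u w).2.1
    have h4 := mul_le_mul_of_nonneg_right h2 h3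
    have h5 := sum_edgeProb_le h u
    linarith

/-- Constants for the lower tail of the out-degrees. -/
theorem exists_outDegree_constants (hM₀ : 1 < M₀) :
    ∃ c τ : ℝ, 0 < c ∧ c ≤ 1 ∧ 0 ≤ τ ∧
      τ * c - (1 - Real.exp (-τ)) * M₀ ≤ -((M₀ + 1) / 2) := by
  have h1 : 0 < (M₀ - 1) / (4 * M₀) := div_pos (by linarith) (by linarith)
  have h2 : (M₀ - 1) / (4 * M₀) < 1 := by
    rw [div_lt_one (by linarith)]
    linarith
  set τ := -Real.log ((M₀ - 1) / (4 * M₀)) with hτ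
  have hτ0 : 0 < τ := by
    have := Real.log_neg h1 h2
    linarith
  -- Both `exp(-τ) M₀` and `τ c` are at most `(M₀ - 1) / 4`, leaving the Chernoff rate `(M₀ + 1) /
  -- 2`, which exceeds one as the union bound requires.
  refine ⟨min 1 ((M₀ - 1) / (4 * τ)), τ, lt_min one_pos (div_pos (by linarith) (by linarith)),
    min_le_left _ _, hτ0.le, ?_⟩
  have h3 : τ * min 1 ((M₀ - 1) / (4 * τ)) ≤ (M₀ - 1) / 4 := by
    refine (mul_le_mul_of_nonneg_left (min_le_right _ _) hτ0.le).trans (le_of_eq ?_)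
    field_simp
  have h4 : Real.exp (-τ) * M₀ = (M₀ - 1) / 4 := by
    rw [hτ, neg_neg, Real.exp_log h1]
    field_simp
  linarith

theorem measureReal_outDegree_lt_le (h : WeightBounds wOut wIn M₀ M₁ M₂)
    (h1 : M₁ * √(M₂ * n) * Real.log n ≤ n) (h2 : √(M₂ * n) ≤ (M₀ - 1) * n) {c τ : ℝ}
    (hτ : 0 ≤ τ) (hc : τ * c - (1 - Real.exp (-τ)) * M₀ ≤ -((M₀ + 1) / 2)) (u : Fin n) :
    (graphLaw wOut wIn).real {ω | (outDegree (toDigraph ω) u : ℝ) < c * Real.log n} ≤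
        Real.exp (-((M₀ + 1) / 2 * Real.log n)) := by
  have hl : 0 ≤ Real.log n := Real.log_natCast_nonneg n
  refine (measureReal_le_integral_exp (X := fun ω =>
    τ * (c * Real.log n) + -τ * outDegree (toDigraph ω) u) fun ω hω => ?_).trans ?_
  · have h3 : (outDegree (toDigraph ω) u : ℝ) < c * Real.log n := hω
    have h4 := mul_le_mul_of_nonneg_left h3.le hτ
    linarith
  · simp_rw [Real.exp_add]
    rw [integral_const_mul]
    refine (mul_le_mul_of_nonneg_left (integral_exp_outDegree_le (-τ) u)
      (Real.exp_nonneg _)).trans ?_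
    rw [← Real.exp_add, Real.exp_le_exp]
    have h3 : Real.exp (-τ) ≤ 1 := Real.exp_le_one_iff.2 (by linarith)
    have h4 := mul_le_mul_of_nonneg_left (le_sum_edgeProb h h1 h2 u) (sub_nonneg.2 h3)
    have h5 := mul_le_mul_of_nonneg_right hc hl
    linarith

/-! ### Entropy. -/

theorem sum_muIn (h : WeightBounds wOut wIn M₀ M₁ M₂) (hn : 0 < n) : ∑ x, muIn wIn x = 1 := by
  have : Nonempty (Fin n) := ⟨⟨0, hn⟩⟩
  unfold muIn
  rw [← Finset.sum_div, div_self]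
  exact (Finset.sum_pos (fun x _ => h.in_pos x) Finset.univ_nonempty).ne'

theorem muIn_nonneg (h : WeightBounds wOut wIn M₀ M₁ M₂) (x : Fin n) : 0 ≤ muIn wIn x :=
  div_nonneg (h.in_pos x).le (Finset.sum_nonneg fun y _ => (h.in_pos y).le)

theorem integral_indicator_graphLaw (A : Set (EdgeConfig n)) (r : ℝ) :
    ∫ ω, A.indicator (fun _ => r) ω ∂(graphLaw wOut wIn) = r * (graphLaw wOut wIn).real A := by
  rw [integral_indicator_const _ (Set.toFinite A).measurableSet, smul_eq_mul, mul_comm]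

/-- The entropy is close to `log log n`. -/
theorem entropy_bounds (h : WeightBounds wOut wIn M₀ M₁ M₂) (hn : 0 < n) {c C : ℝ} (hc1 : c ≤ 1)
    (hcl : 1 ≤ c * Real.log n) (hcC : c ≤ C)
    (hlow : ∀ u, (graphLaw wOut wIn).real
      {ω | (outDegree (toDigraph ω) u : ℝ) < c * Real.log n} ≤ Real.exp (-Real.log n))
    (hupp : ∀ u, (graphLaw wOut wIn).real
      {ω | C * Real.log n < outDegree (toDigraph ω) u} ≤ Real.exp (-Real.log n)) :
    Real.log (c * Real.log n) - 1 ≤ entropy wOut wIn ∧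
      entropy wOut wIn ≤ Real.log (C * Real.log n) + 1 := by
  have hl : 0 ≤ Real.log n := Real.log_natCast_nonneg n
  have hnR : (0 : ℝ) < n := by exact_mod_cast hn
  -- Outside the degree window, `log (D ∨ 1)` still lies in `[0, log n]`, and each tail has
  -- probability at most `1/n`: the error is at most one.
  have hexp : Real.log n * Real.exp (-Real.log n) ≤ 1 := by
    have h1 := Real.add_one_le_exp (Real.log n)
    rw [Real.exp_neg, ← div_eq_mul_inv, div_le_one (Real.exp_pos _)]
    linarith
  have hCl : 1 ≤ C * Real.log n := hcl.trans (mul_le_mul_of_nonneg_right hcC hl)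
  have hlogc : 0 ≤ Real.log (c * Real.log n) := Real.log_nonneg hcl
  have hlogcl : Real.log (c * Real.log n) ≤ Real.log n := by
    have h1 := Real.log_le_sub_one_of_pos (show 0 < c * Real.log n by linarith)
    have h2 := mul_le_mul_of_nonneg_right hc1 hl
    linarith
  have hdegn : ∀ (ω : EdgeConfig n) (u : Fin n), (outDegree (toDigraph ω) u : ℝ) ≤ n := by
    intro ω u
    rw [outDegree_eq_card]
    have := Finset.card_le_univ (outNbrs (toDigraph ω) u)
    rw [Fintype.card_fin] at this
    exact_mod_cast this
  have hone : ∀ u, Real.log (c * Real.log n) - 1 ≤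
      ∫ ω, Real.log (max (outDegree (toDigraph ω) u : ℝ) 1) ∂(graphLaw wOut wIn) := by
    intro u
    set A := {ω : EdgeConfig n | (outDegree (toDigraph ω) u : ℝ) < c * Real.log n}
    have h1 : ∀ ω, Real.log (c * Real.log n) -
        A.indicator (fun _ => Real.log (c * Real.log n)) ω ≤
        Real.log (max (outDegree (toDigraph ω) u : ℝ) 1) := by
      intro ω
      by_cases hω : ω ∈ A
      · rw [Set.indicator_of_mem hω, sub_self]
        exact Real.log_nonneg (le_max_right _ _)
      · rw [Set.indicator_of_notMem hω, sub_zero]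
        refine Real.log_le_log (by linarith) (le_max_of_le_left ?_)
        exact not_lt.1 hω
    have h2 := integral_mono (μ := graphLaw wOut wIn) (integrable_graphLaw _)
      (integrable_graphLaw _) h1
    rw [integral_sub (integrable_graphLaw _) (integrable_graphLaw _), integral_const,
      probReal_univ, one_smul, integral_indicator_graphLaw] at h2
    refine le_trans ?_ h2
    have h3 := mul_le_mul hlogcl (hlow u) measureReal_nonneg hl
    linarith
  have htwo : ∀ u, ∫ ω, Real.log (max (outDegree (toDigraph ω) u : ℝ) 1) ∂(graphLaw wOut wIn) ≤
      Real.log (C * Real.log n) + 1 := by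
    intro u
    set A := {ω : EdgeConfig n | C * Real.log n < outDegree (toDigraph ω) u}
    have h1 : ∀ ω, Real.log (max (outDegree (toDigraph ω) u : ℝ) 1) ≤
        Real.log (C * Real.log n) + A.indicator (fun _ => Real.log n) ω := by
      intro ω
      by_cases hω : ω ∈ A
      · rw [Set.indicator_of_mem hω]
        have h2 : Real.log (max (outDegree (toDigraph ω) u : ℝ) 1) ≤ Real.log n := by
          refine Real.log_le_log (by positivity) (max_le (hdegn ω u) ?_)
          exact_mod_cast hn
        linarith [Real.log_nonneg hCl]
      · rw [Set.indicator_of_notMem hω, add_zero]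
        exact Real.log_le_log (by positivity) (max_le (not_lt.1 hω) hCl)
    have h2 := integral_mono (μ := graphLaw wOut wIn) (integrable_graphLaw _)
      (integrable_graphLaw _) h1
    rw [integral_add (integrable_graphLaw _) (integrable_graphLaw _), integral_const,
      probReal_univ, one_smul, integral_indicator_graphLaw] at h2
    refine h2.trans ?_
    have h3 := mul_le_mul_of_nonneg_left (hupp u) hl
    linarith
  have hsum := sum_muIn h hn
  unfold entropy
  constructor
  · calc Real.log (c * Real.log n) - 1 =
          ∑ x, muIn wIn x * (Real.log (c * Real.log n) - 1) := by
          rw [← Finset.sum_mul, hsum, one_mul]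
      _ ≤ _ := Finset.sum_le_sum fun x _ =>
          mul_le_mul_of_nonneg_left (hone x) (muIn_nonneg h x)
  · calc _ ≤ ∑ x, muIn wIn x * (Real.log (C * Real.log n) + 1) :=
          Finset.sum_le_sum fun x _ => mul_le_mul_of_nonneg_left (htwo x) (muIn_nonneg h x)
      _ = _ := by rw [← Finset.sum_mul, hsum, one_mul]

/-- Non-asymptotic form of the concentration of the minimal mass. -/
theorem measureReal_compl_isLeast_le {a b q q₀ t δ θ pl pu : ℝ} {s h : ℕ} (x₀ : Fin n)
    (ha : 1 ≤ a) (hb : 2 ≤ b) (hab : a ≤ b) (hθ : θ ≤ (b ^ s)⁻¹) (ht : 0 ≤ t)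
    (hq : 0 ≤ q) (hq₀ : 0 ≤ q₀)
    (hqs : ∀ (u : Fin n) (W : Finset (Fin n)), (W.card : ℝ) ≤ 2 * b ^ s →
      ∑ w ∈ W, (edgeProb wOut wIn u w : ℝ) ≤ q)
    (hqh : ∀ (u : Fin n) (W : Finset (Fin n)), (W.card : ℝ) ≤ 2 * b ^ h →
      ∑ w ∈ W, (edgeProb wOut wIn u w : ℝ) ≤ q₀)
    (hlow : ∀ u, (graphLaw wOut wIn).real {ω | (outDegree (toDigraph ω) u : ℝ) < a} ≤ pl)
    (hupp : ∀ u, (graphLaw wOut wIn).real {ω | b < outDegree (toDigraph ω) u} ≤ pu)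
    (hδ : s * (4 * (b / a) ^ s * q + 3 * Real.log n * (a ^ h)⁻¹) ≤ δ)
    (T : EdgeConfig n → Fin n → Set (Fin n × Fin n))
    (hT : ∀ ω x, IsGreedyTree (toDigraph ω) x s θ (T ω x)) :
    (graphLaw wOut wIn).real {ω | ∃ m : ℝ,
      IsLeast ((fun x => totalPathMass (toDigraph ω) (T ω x) x s) ''
        treeRoots (toDigraph ω) h) m ∧ |m - 1| ≤ δ}ᶜ ≤
      n * pl + n * pu + n * (s * Real.exp (-(3 * Real.log n))) +
        h * Real.exp ((Real.exp t - 1) * (2 * b ^ h * q₀) - t) := by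
  have hl : 0 ≤ Real.log n := Real.log_natCast_nonneg n
  have ha0 : 0 < a := by linarith
  have hb0 : 0 < b := by linarith
  -- Bad events: a degree below `a`; a degree above `b`; too many excess edges at some level from
  -- some vertex; an excess edge within radius `h` of `x₀`. The ball-size conditions in the last two
  -- hold automatically off `A₂`.
  set A₁ : Set (EdgeConfig n) := ⋃ u ∈ (Finset.univ : Finset (Fin n)),
    {ω | (outDegree (toDigraph ω) u : ℝ) < a} with hA₁
  set A₂ : Set (EdgeConfig n) := ⋃ u ∈ (Finset.univ : Finset (Fin n)),
    {ω | b < outDegree (toDigraph ω) u} with hA₂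
  set A₃ : Set (EdgeConfig n) := ⋃ x ∈ (Finset.univ : Finset (Fin n)), ⋃ j ∈ Finset.range s,
    {ω | ((ball (toDigraph ω) x (j + 1)).card : ℝ) ≤ 2 * b ^ (j + 1) ∧
      4 * b ^ (j + 1) * q + 3 * Real.log n ≤ ((excessAt (toDigraph ω) x j).card : ℝ)} with hA₃
  set A₄ : Set (EdgeConfig n) := ⋃ j ∈ Finset.range h,
    {ω | ((ball (toDigraph ω) x₀ (j + 1)).card : ℝ) ≤ 2 * b ^ h ∧
      1 ≤ ((excessAt (toDigraph ω) x₀ j).card : ℝ)} with hA₄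
  have hm₁ : (graphLaw wOut wIn).real A₁ ≤ n * pl := by
    refine (measureReal_biUnion_finset_le _ _).trans
      ((Finset.sum_le_sum fun u _ => hlow u).trans ?_)
    simp
  have hm₂ : (graphLaw wOut wIn).real A₂ ≤ n * pu := by
    refine (measureReal_biUnion_finset_le _ _).trans
      ((Finset.sum_le_sum fun u _ => hupp u).trans ?_)
    simp
  have hm₃ : (graphLaw wOut wIn).real A₃ ≤ n * (s * Real.exp (-(3 * Real.log n))) := by
    refine (measureReal_biUnion_finset_le _ _).trans
      ((Finset.sum_le_sum (g := fun _ => s * Real.exp (-(3 * Real.log n))) fun u _ => ?_).trans ?_)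
    · refine (measureReal_biUnion_finset_le _ _).trans
        ((Finset.sum_le_sum (g := fun _ => Real.exp (-(3 * Real.log n))) fun j hj => ?_).trans ?_)
      · have hj' : j + 1 ≤ s := Finset.mem_range.1 hj
        -- With `t = 1` and `exp 1 - 1 ≤ 2`, the term `4 b ^ (j + 1) q` in `R` cancels the
        -- exponential moment and `exp(-3 log n)` remains.
        have h1 := measureReal_excessAt_le (wOut := wOut) (wIn := wIn) (K := 2 * b ^ (j + 1))
          (q := q) (t := 1) (R := 4 * b ^ (j + 1) * q + 3 * Real.log n) zero_le_one hq
          (fun u W hW => hqs u W (hW.trans (mul_le_mul_of_nonneg_left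
            (pow_le_pow_right₀ (by linarith) hj') zero_le_two))) u j
        refine h1.trans (Real.exp_le_exp.2 ?_)
        have h2 : Real.exp 1 - 1 ≤ 2 := by linarith [Real.exp_one_lt_d9]
        have h3 := mul_le_mul_of_nonneg_right h2 (show 0 ≤ 2 * b ^ (j + 1) * q by positivity)
        linarith
      · simp
    · simp
  have hm₄ : (graphLaw wOut wIn).real A₄ ≤
      h * Real.exp ((Real.exp t - 1) * (2 * b ^ h * q₀) - t) := by
    refine (measureReal_biUnion_finset_le _ _).trans
      ((Finset.sum_le_sum (g := fun _ => Real.exp ((Real.exp t - 1) * (2 * b ^ h * q₀) - t))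
        fun j hj => ?_).trans ?_)
    · have h1 := measureReal_excessAt_le (wOut := wOut) (wIn := wIn) (R := 1) ht hq₀ hqh x₀ j
      rwa [mul_one] at h1
    · simp
  have hsub : {ω | ∃ m : ℝ,
      IsLeast ((fun x => totalPathMass (toDigraph ω) (T ω x) x s) ''
        treeRoots (toDigraph ω) h) m ∧ |m - 1| ≤ δ}ᶜ ⊆ A₁ ∪ A₂ ∪ A₃ ∪ A₄ := by
    intro ω hω
    by_contra hgood
    apply hω
    simp only [hA₁, hA₂, hA₃, hA₄, Set.mem_union, Set.mem_iUnion, Set.mem_ofPred_eq, not_or,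
      not_exists, Finset.mem_univ, Finset.mem_range, exists_prop, true_and, not_and, not_lt,
      not_le] at hgood
    obtain ⟨⟨⟨hg₁, hg₂⟩, hg₃⟩, hg₄⟩ := hgood
    have hne : x₀ ∈ treeRoots (toDigraph ω) h := by
      refine mem_treeRoots_of_excessAt_eq_empty fun j hj => ?_
      have h1 := hg₄ j hj ((card_ball_le hb hg₂ (j + 1)).trans (mul_le_mul_of_nonneg_left
            (pow_le_pow_right₀ (by linarith) hj) zero_le_two))
      rw [← Finset.card_eq_zero]
      have h2 : (excessAt (toDigraph ω) x₀ j).card < 1 := by exact_mod_cast h1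
      omega
    obtain ⟨x, hx, hmin⟩ := Set.exists_min_image (treeRoots (toDigraph ω) h)
      (fun x => totalPathMass (toDigraph ω) (T ω x) x s) (Set.toFinite _) ⟨x₀, hne⟩
    refine ⟨_, ⟨⟨x, hx, rfl⟩, by rintro _ ⟨y, hy, rfl⟩; exact hmin y hy⟩, ?_⟩
    have hup := totalPathMass_le_one (G := toDigraph ω) (T := T ω x) (x := x) s
    have hlo := (hT ω x).one_sub_totalPathMass_le ha (fun v => ⟨hg₁ v, hg₂ v⟩) hθ
    rw [abs_sub_comm, abs_of_nonneg (sub_nonneg.2 hup)]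
    refine hlo.trans (le_trans ?_ hδ)
    have hterm : ∀ j ∈ Finset.range s,
        ((excessAt (toDigraph ω) x j).card : ℝ) * (a ^ (j + 1))⁻¹ ≤
          4 * (b / a) ^ s * q + 3 * Real.log n * (a ^ h)⁻¹ := by
      intro j hj
      have hj' : j + 1 ≤ s := Finset.mem_range.1 hj
      -- Being a root removes exactly the levels where `a ^ (-(j + 1))` would be too large to beat
      -- the `3 log n` fluctuation.
      by_cases hjh : j < h
      · rw [excessAt_eq_empty_of_mem_treeRoots hx hjh]
        simp only [Finset.card_empty, Nat.cast_zero, zero_mul]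
        positivity
      · have h1 := (hg₃ x j hj' (card_ball_le hb hg₂ (j + 1))).le
        calc ((excessAt (toDigraph ω) x j).card : ℝ) * (a ^ (j + 1))⁻¹
            ≤ (4 * b ^ (j + 1) * q + 3 * Real.log n) * (a ^ (j + 1))⁻¹ := by gcongr
          _ = 4 * (b / a) ^ (j + 1) * q + 3 * Real.log n * (a ^ (j + 1))⁻¹ := by
              rw [div_pow]
              ring
          _ ≤ _ := by
              have h2 : (b / a) ^ (j + 1) ≤ (b / a) ^ s :=
                pow_le_pow_right₀ ((one_le_div ha0).2 hab) hj'
              have h3 : (a ^ (j + 1))⁻¹ ≤ (a ^ h)⁻¹ :=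
                inv_anti₀ (by positivity) (pow_le_pow_right₀ ha (by omega))
              gcongr
    refine (Finset.sum_le_sum hterm).trans (le_of_eq ?_)
    rw [Finset.sum_const, Finset.card_range, nsmul_eq_mul]
  refine (measureReal_mono hsub).trans ?_
  have h1 := measureReal_union_le (μ := graphLaw wOut wIn) (A₁ ∪ A₂ ∪ A₃) A₄
  have h2 := measureReal_union_le (μ := graphLaw wOut wIn) (A₁ ∪ A₂) A₃
  have h3 := measureReal_union_le (μ := graphLaw wOut wIn) A₁ A₂
  linarith

end Estimates

/-! ### Asymptotics -/

section Asymptotics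

theorem tendsto_pow_mul_exp_neg (k : ℕ) {β : ℝ} (hβ : 0 < β) :
    Tendsto (fun l : ℝ => l ^ k * Real.exp (-(β * l))) atTop (𝓝 0) := by
  have := tendsto_rpow_mul_exp_neg_mul_atTop_nhds_zero k β hβ
  simpa [Real.rpow_natCast] using this

theorem pow_eq_exp_mul_log {b : ℝ} (hb : 0 < b) (k : ℕ) : b ^ k = Real.exp (k * Real.log b) := by
  rw [Real.exp_nat_mul, Real.exp_log hb]

/-- If at most `2 n ^ (1 - 2β)` vertices are known, the collision rate is of order `n ^ (-β)`, up to
logarithms. -/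
theorem sqrt_mul_div_le {K M β l N : ℝ} (hM : 0 ≤ M) (hN : N = Real.exp l)
    (hK : K ≤ 2 * Real.exp ((1 - 2 * β) * l)) :
    √(K * M / N) ≤ √(2 * M) * Real.exp (-(β * l)) := by
  have h1 : K * M / N ≤ 2 * M * Real.exp (-(β * l)) ^ 2 := by
    rw [hN, ← Real.exp_nat_mul, div_le_iff₀ (Real.exp_pos l), mul_assoc, ← Real.exp_add]
    calc K * M ≤ 2 * Real.exp ((1 - 2 * β) * l) * M := by gcongr
      _ = 2 * M * Real.exp ((1 - 2 * β) * l) := by ring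
      _ = _ := by
        congr 2
        push_cast
        ring
  refine (Real.sqrt_le_sqrt h1).trans (le_of_eq ?_)
  rw [Real.sqrt_mul (by positivity), Real.sqrt_sq (Real.exp_nonneg _)]

/-- Comparison of degrees, entropy and radii when all logarithms of degrees and the entropy are
within `D` of `L = log l`. -/
theorem radius_bounds {l L D H γ ε a b : ℝ} {s h : ℕ} (hl : 0 < l) (hD : 1 ≤ D)
    (hγ : γ ∈ Set.Ioo (0 : ℝ) 1) (hε : ε ∈ Set.Ioo (0 : ℝ) 1)
    (hL : 40 * D / γ ≤ L) (hLl : L + D ≤ ε * l / 80) (ha : 0 < a) (hab : a ≤ b)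
    (hla : L - D ≤ Real.log a) (hlb : Real.log b ≤ L + D)
    (hH : L - D ≤ H) (hH' : H ≤ L + D) (hs : (s : ℝ) ≤ (1 - γ) * (l / H))
    (hh : h = ⌊ε * l / (20 * H)⌋₊) :
    (s : ℝ) ≤ l ∧ (h : ℝ) ≤ l ∧ b ^ s ≤ Real.exp ((1 - γ / 2) * l) ∧
      Real.exp (-((1 + γ) * H * s)) ≤ (b ^ s)⁻¹ ∧ (b / a) ^ s ≤ Real.exp (γ / 16 * l) ∧
      (a ^ h)⁻¹ ≤ Real.exp (-(ε / 80 * l)) ∧ b ^ h ≤ Real.exp (1 / 10 * l) := by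
  obtain ⟨hγ0, hγ1⟩ := hγ
  obtain ⟨hε0, hε1⟩ := hε
  have hb : 0 < b := lt_of_lt_of_le ha hab
  have hlab : Real.log a ≤ Real.log b := Real.log_le_log ha hab
  have hL' : 40 * D ≤ γ * L := by
    rw [div_le_iff₀ hγ0] at hL
    linarith
  have hDL : 40 * D ≤ L := by nlinarith
  have hH1 : 1 ≤ H := by linarith
  have hH0 : 0 < H := by linarith
  -- All logarithms agree up to `2 D`, a small fraction of `γ H`; this is the slack behind the
  -- comparisons involving `γ`.
  have hγL : γ * H ≥ 39 * D := by nlinarith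
  have hsH : s * H ≤ (1 - γ) * l := by
    rw [← mul_div_assoc, le_div_iff₀ hH0] at hs
    exact hs
  have hs0 : (0 : ℝ) ≤ s := Nat.cast_nonneg s
  have hh0 : (0 : ℝ) ≤ h := Nat.cast_nonneg h
  have hhle : (h : ℝ) ≤ ε * l / (20 * H) := by
    rw [hh]
    exact Nat.floor_le (by positivity)
  have hhlt : ε * l / (20 * H) < h + 1 := by
    rw [hh]
    exact Nat.lt_floor_add_one _
  rw [le_div_iff₀ (by positivity)] at hhle
  rw [div_lt_iff₀ (by positivity)] at hhlt
  have hεl : ε * l ≤ l := by nlinarith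
  refine ⟨?_, ?_, ?_, ?_, ?_, ?_, ?_⟩
  · nlinarith
  · nlinarith
  · rw [pow_eq_exp_mul_log hb, Real.exp_le_exp]
    have h1 : (1 - γ) * Real.log b ≤ (1 - γ / 2) * H := by nlinarith
    have h2 : 0 ≤ Real.log b := by linarith
    have h3 := mul_le_mul_of_nonneg_right hsH h2
    have h4 := mul_le_mul_of_nonneg_right h1 hl.le
    refine le_of_mul_le_mul_right ?_ hH0
    nlinarith
  · rw [pow_eq_exp_mul_log hb, ← Real.exp_neg, Real.exp_le_exp, neg_le_neg_iff]
    have h1 : Real.log b ≤ (1 + γ) * H := by nlinarith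
    nlinarith
  · have hba : 0 < b / a := div_pos hb ha
    rw [pow_eq_exp_mul_log hba, Real.exp_le_exp, Real.log_div hb.ne' ha.ne']
    have h1 : Real.log b - Real.log a ≤ γ / 16 * H := by linarith
    have h2 := mul_le_mul_of_nonneg_left h1 hs0
    have h3 : s * H ≤ l := by nlinarith
    nlinarith
  · rw [pow_eq_exp_mul_log ha, ← Real.exp_neg, Real.exp_le_exp, neg_le_neg_iff]
    have h1 : H ≤ 2 * Real.log a := by linarith
    have h2 : Real.log a ≤ ε * l / 80 := by linarith
    -- The floor gives a lower bound on `h + 1` only; the surplus `log a` costs half of the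
    -- exponent, turning `ε / 40` into `ε / 80`.
    have h3 : ε * l < 40 * ((h + 1) * Real.log a) := by
      have := mul_le_mul_of_nonneg_left h1 (show (0 : ℝ) ≤ 20 * (h + 1) by positivity)
      linarith
    linarith
  · rw [pow_eq_exp_mul_log hb, Real.exp_le_exp]
    have h1 : Real.log b ≤ 2 * H := by linarith
    have h2 := mul_le_mul_of_nonneg_left h1 hh0
    linarith

/-- The second moment of the in-weights is controlled by a higher moment. -/
theorem sum_sq_le {n : ℕ} {w : Fin n → ℝ} {M η : ℝ} (hη : 0 < η) (hw : ∀ x, 0 < w x)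
    (h : ∑ x, w x ^ (2 + η) ≤ M * n) : ∑ x, w x ^ 2 ≤ (1 + M) * n := by
  have h1 : ∀ x, w x ^ 2 ≤ 1 + w x ^ (2 + η) := by
    intro x
    rcases le_total (w x) 1 with hx | hx
    · have h2 : w x ^ 2 ≤ 1 := pow_le_one₀ (hw x).le hx
      have h3 := Real.rpow_nonneg (hw x).le (2 + η)
      linarith
    · have h2 : w x ^ (2 : ℝ) ≤ w x ^ (2 + η) :=
        Real.rpow_le_rpow_of_exponent_le hx (by linarith)
      rw [Real.rpow_two] at h2
      linarith
  calc ∑ x, w x ^ 2 ≤ ∑ x, (1 + w x ^ (2 + η)) := Finset.sum_le_sum fun x _ => h1 x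
    _ = n + ∑ x, w x ^ (2 + η) := by
        rw [Finset.sum_add_distrib]
        simp
    _ ≤ _ := by linarith

/-- Sets whose complements have probability tending to `0` have probability tending to `1`. -/
theorem tendsto_measure_one_of_compl {Ω : ℕ → Type*} [∀ n, MeasurableSpace (Ω n)]
    [∀ n, DiscreteMeasurableSpace (Ω n)] (μ : ∀ n, Measure (Ω n))
    [∀ n, IsProbabilityMeasure (μ n)] (S : ∀ n, Set (Ω n)) {r : ℕ → ℝ}
    (hr : Tendsto r atTop (𝓝 0)) (h : ∀ᶠ n in atTop, (μ n).real (S n)ᶜ ≤ r n) :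
    Tendsto (fun n => μ n (S n)) atTop (𝓝 1) := by
  have h1 : Tendsto (fun n => (μ n).real (S n)ᶜ) atTop (𝓝 0) :=
    tendsto_of_tendsto_of_tendsto_of_le_of_le' tendsto_const_nhds hr
      (Eventually.of_forall fun _ => measureReal_nonneg) h
  have h2 : Tendsto (fun n => ENNReal.ofReal (1 - (μ n).real (S n)ᶜ)) atTop
      (𝓝 (ENNReal.ofReal (1 - 0))) :=
    (ENNReal.continuous_ofReal.tendsto _).comp (tendsto_const_nhds.sub h1)
  rw [sub_zero, ENNReal.ofReal_one] at h2
  refine h2.congr fun n => ?_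
  rw [probReal_compl_eq_one_sub (MeasurableSet.of_discrete), sub_sub_cancel]
  exact ofReal_measureReal

/-- Rate of decay of the probability of the bad event, as a function of `l = log n`. -/
def badRate (M₀ l : ℝ) : ℝ :=
  Real.exp (-((M₀ - 1) / 2 * l)) + Real.exp (-(2 * l)) + l * Real.exp (-(2 * l)) +
    Real.exp 1 * (l * Real.exp (-(1 / 10 * l)))

theorem tendsto_badRate {M₀ : ℝ} (hM₀ : 1 < M₀) : Tendsto (badRate M₀) atTop (𝓝 0) := by
  have h1 := (((tendsto_pow_mul_exp_neg 0
    (show 0 < (M₀ - 1) / 2 by linarith)).add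
      (tendsto_pow_mul_exp_neg 0 two_pos)).add
      (tendsto_pow_mul_exp_neg 1 two_pos)).add
      ((tendsto_pow_mul_exp_neg 1
        (show (0 : ℝ) < 1 / 10 by norm_num)).const_mul (Real.exp 1))
  simp only [pow_zero, pow_one, one_mul, mul_zero, add_zero] at h1
  exact h1

/-- Tilting by `t = l / 10` makes even one excess edge near `x₀` cost `n ^ (-1/10)`, and the
exponential moment stays bounded because `1/10 + 1/10 - 9/20 = -1/4`. -/
theorem badProb_le {M₀ A l N q₀ bh : ℝ} {s h : ℕ} (hln : N = Real.exp l)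
    (hl : 0 < l) (_hA : 0 ≤ A) (hs : (s : ℝ) ≤ l) (hh : (h : ℝ) ≤ l) (hbh0 : 0 ≤ bh)
    (hbh : bh ≤ Real.exp (1 / 10 * l)) (hq0 : 0 ≤ q₀)
    (hq : q₀ ≤ A * l * Real.exp (-(9 / 20 * l)))
    (e4 : 2 * A * (l ^ 1 * Real.exp (-(1 / 4 * l))) ≤ 1) :
    N * Real.exp (-((M₀ + 1) / 2 * l)) + N * Real.exp (-(3 * l)) +
      N * (s * Real.exp (-(3 * l))) +
      h * Real.exp ((Real.exp (1 / 10 * l) - 1) * (2 * bh * q₀) - 1 / 10 * l) ≤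
      badRate M₀ l := by
  have t1 : N * Real.exp (-((M₀ + 1) / 2 * l)) = Real.exp (-((M₀ - 1) / 2 * l)) := by
    rw [hln, ← Real.exp_add]
    ring_nf
  have t2 : N * Real.exp (-(3 * l)) = Real.exp (-(2 * l)) := by
    rw [hln, ← Real.exp_add]
    ring_nf
  have t3 : N * (s * Real.exp (-(3 * l))) ≤ l * Real.exp (-(2 * l)) := by
    calc N * (s * Real.exp (-(3 * l))) = s * (N * Real.exp (-(3 * l))) := by ring
      _ = s * Real.exp (-(2 * l)) := by rw [t2]
      _ ≤ _ := mul_le_mul_of_nonneg_right hs (Real.exp_nonneg _)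
  have u1 : (Real.exp (1 / 10 * l) - 1) * (2 * bh * q₀) ≤ 1 := by
    calc _ ≤ Real.exp (1 / 10 * l) * (2 * Real.exp (1 / 10 * l) *
          (A * l * Real.exp (-(9 / 20 * l)))) := by
          gcongr
          linarith
      _ = 2 * A * (l ^ 1 * (Real.exp (1 / 10 * l) * Real.exp (1 / 10 * l) *
          Real.exp (-(9 / 20 * l)))) := by ring
      _ = 2 * A * (l ^ 1 * Real.exp (-(1 / 4 * l))) := by
          rw [← Real.exp_add, ← Real.exp_add]
          ring_nf
      _ ≤ 1 := e4
  have t4 : h * Real.exp ((Real.exp (1 / 10 * l) - 1) * (2 * bh * q₀) - 1 / 10 * l) ≤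
      Real.exp 1 * (l * Real.exp (-(1 / 10 * l))) := by
    calc _ ≤ l * Real.exp (1 - 1 / 10 * l) :=
          mul_le_mul hh (Real.exp_le_exp.2 (by linarith)) (Real.exp_nonneg _) hl.le
      _ = _ := by
          rw [sub_eq_add_neg, Real.exp_add]
          ring
  unfold badRate
  rw [t1, t2]
  linarith

/-- Exponent count: the degree ratio costs `γ / 16` and the collision rate gains `γ / 4`, a net gain
of `3γ / 16`. -/
theorem loss_le {A l q R Y γ ε : ℝ} {s : ℕ} (hl : 0 < l) (hs : (s : ℝ) ≤ l)
    (hR0 : 0 ≤ R) (hR : R ≤ Real.exp (γ / 16 * l)) (hq0 : 0 ≤ q)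
    (hq : q ≤ A * l * Real.exp (-(γ / 4 * l))) (hY0 : 0 ≤ Y)
    (hY : Y ≤ Real.exp (-(ε / 80 * l))) :
    s * (4 * R * q + 3 * l * Y) ≤
      4 * A * (l ^ 2 * Real.exp (-(3 * γ / 16 * l))) + 3 * (l ^ 2 * Real.exp (-(ε / 80 * l))) := by
  calc _ ≤ l * (4 * Real.exp (γ / 16 * l) * (A * l * Real.exp (-(γ / 4 * l))) +
          3 * l * Real.exp (-(ε / 80 * l))) := by gcongr
    _ = 4 * A * (l ^ 2 * (Real.exp (γ / 16 * l) * Real.exp (-(γ / 4 * l)))) +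
        3 * (l ^ 2 * Real.exp (-(ε / 80 * l))) := by ring
    _ = _ := by
        rw [← Real.exp_add]
        ring_nf

/-- The bad event has small probability as soon as `l = log n` is large. -/
theorem measureReal_compl_isLeast_le_badRate {n : ℕ} {wOut wIn : Fin n → ℝ}
    {M₀ M₁ M c τ C D γ ε δ l : ℝ} {s : ℕ} (hw : WeightBounds wOut wIn M₀ M₁ M)
    (hM₁ : 1 < M₁) (hM0 : 0 ≤ M) (hc0 : 0 < c) (hc1 : c ≤ 1) (hτ : 0 ≤ τ)
    (hcτ : τ * c - (1 - Real.exp (-τ)) * M₀ ≤ -((M₀ + 1) / 2)) (hC : C = 2 * M₁ ^ 2 + 3)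
    (hD1 : 1 ≤ D) (hcD : -(D - 1) ≤ Real.log c) (hCD : Real.log C ≤ D - 1)
    (hε : ε ∈ Set.Ioo (0 : ℝ) 1) (hγ : γ ∈ Set.Ioo (0 : ℝ) 1) (hn : 0 < n)
    (hl : Real.log n = l)
    (e1 : 40 * D / γ ≤ Real.log l) (e2 : Real.log l + D ≤ ε * l / 80)
    (e3 : 4 * (M₁ * √(2 * M)) * (l ^ 2 * Real.exp (-(3 * γ / 16 * l))) +
      3 * (l ^ 2 * Real.exp (-(ε / 80 * l))) ≤ δ)
    (e4 : 2 * (M₁ * √(2 * M)) * (l ^ 1 * Real.exp (-(1 / 4 * l))) ≤ 1)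
    (e5 : M₁ * √M * (l ^ 1 * Real.exp (-(1 / 2 * l))) ≤ 1)
    (e6 : √M * (l ^ 0 * Real.exp (-(1 / 2 * l))) ≤ M₀ - 1) (e7 : 1 / c ≤ l) (e8 : 1 ≤ l)
    (hs : (s : ℝ) ≤ (1 - γ) * entropicTime wOut wIn)
    (T : EdgeConfig n → Fin n → Set (Fin n × Fin n))
    (hT : ∀ ω x, IsGreedyTree (toDigraph ω) x s (massThreshold wOut wIn γ s) (T ω x)) :
    (graphLaw wOut wIn).real {ω | ∃ m : ℝ,
      IsLeast ((fun x => totalPathMass (toDigraph ω) (T ω x) x s) ''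
        epsRoots wOut wIn ε ω) m ∧ |m - 1| ≤ δ}ᶜ ≤ badRate M₀ l := by
  have hM₀ := hw.one_lt
  have hC5 : 5 ≤ C := by
    have := one_lt_pow₀ hM₁ two_ne_zero
    linarith
  have hC0 : 0 < C := by linarith
  have hnR : (0 : ℝ) < n := by exact_mod_cast hn
  have hln : (n : ℝ) = Real.exp l := by rw [← hl, Real.exp_log hnR]
  have hl0 : 0 < l := by linarith
  have hM₁0 : 0 ≤ M₁ := by linarith
  have hM₀l := mul_le_mul_of_nonneg_right (show 1 ≤ (M₀ + 1) / 2 by linarith) hl0.le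
  have hCl2 := mul_le_mul hC5 e8 zero_le_one hC0.le
  have hsqrtn : √(M * n) = √M * Real.exp (-(1 / 2 * l)) * n := by
    rw [Real.sqrt_mul hM0, mul_assoc]
    congr 1
    rw [hln, ← Real.exp_add, Real.sqrt_eq_iff_eq_sq (Real.exp_nonneg _) (Real.exp_nonneg _),
      ← Real.exp_nat_mul]
    congr 1
    push_cast
    ring
  have h1 : M₁ * √(M * n) * Real.log n ≤ n := by
    rw [hsqrtn, hl]
    calc _ = M₁ * √M * (l ^ 1 * Real.exp (-(1 / 2 * l))) * n := by ring
      _ ≤ 1 * n := mul_le_mul_of_nonneg_right e5 hnR.le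
      _ = n := one_mul _
  have h2 : √(M * n) ≤ (M₀ - 1) * n := by
    rw [hsqrtn]
    refine mul_le_mul_of_nonneg_right ?_ hnR.le
    simpa using e6
  have hlow := measureReal_outDegree_lt_le hw h1 h2 hτ hcτ
  have hupp := measureReal_outDegree_gt_le hw
  rw [← hC] at hupp
  rw [hl] at hlow hupp
  have hcl : 1 ≤ c * l := by
    rw [div_le_iff₀ hc0] at e7
    linarith
  obtain ⟨hH, hH'⟩ := entropy_bounds hw hn (C := C) hc1 (by rwa [hl])
    (by linarith) (fun u => by rw [hl]; exact (hlow u).trans (Real.exp_le_exp.2 (by linarith)))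
    (fun u => by rw [hl]; exact (hupp u).trans (Real.exp_le_exp.2 (by linarith)))
  rw [hl, Real.log_mul hc0.ne' hl0.ne'] at hH
  rw [hl, Real.log_mul hC0.ne' hl0.ne'] at hH'
  obtain ⟨b1, b2, b3, b4, b5, b6, b7⟩ := radius_bounds (l := l) (L := Real.log l) (D := D)
    (a := c * l) (b := C * l) (s := s) hl0 hD1 hγ hε e1 e2 (by positivity)
    (mul_le_mul_of_nonneg_right (by linarith) hl0.le)
    (by rw [Real.log_mul hc0.ne' hl0.ne']; linarith)
    (by rw [Real.log_mul hC0.ne' hl0.ne']; linarith)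
    (by linarith) (by linarith) (by rwa [entropicTime, hl] at hs) rfl
  -- `β` is fixed by `1 - 2β = 1 - γ / 2`, the exponent of `b ^ s`; for radius `h` below it is `1 -
  -- 2β = 1 / 10`.
  have hq1 := sqrt_mul_div_le (K := 2 * (C * l) ^ s) (β := γ / 4) hM0 hln
    (mul_le_mul_of_nonneg_left (b3.trans_eq (by ring_nf)) zero_le_two)
  have hrad : radius wOut wIn ε = ⌊ε * l / (20 * entropy wOut wIn)⌋₊ := by rw [radius, hl]
  rw [← hrad] at b2 b6 b7
  have hq2 := sqrt_mul_div_le (K := 2 * (C * l) ^ radius wOut wIn ε) (β := 9 / 20) hM0 hln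
    (mul_le_mul_of_nonneg_left (b7.trans_eq (by ring_nf)) zero_le_two)
  have hA0 : 0 ≤ M₁ * √(2 * M) := by positivity
  have hCl : 0 < C * l := by positivity
  have key := measureReal_compl_isLeast_le (wOut := wOut) (wIn := wIn)
    (a := c * l) (b := C * l) (q := M₁ * l * √(2 * (C * l) ^ s * M / n))
    (q₀ := M₁ * l * √(2 * (C * l) ^ radius wOut wIn ε * M / n)) (t := 1 / 10 * l) (δ := δ)
    (h := radius wOut wIn ε) (θ := massThreshold wOut wIn γ s)
    ⟨0, hn⟩ hcl (by linarith) (mul_le_mul_of_nonneg_right (by linarith) hl0.le) b4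
    (by positivity) (by positivity) (by positivity)
    (fun u W hW => (sum_edgeProb_le_sqrt hw u W hW).trans_eq (by rw [hl]))
    (fun u W hW => (sum_edgeProb_le_sqrt hw u W hW).trans_eq (by rw [hl]))
    hlow hupp ?_ T hT
  · rw [hl] at key
    refine key.trans (badProb_le hln hl0 hA0 b1 b2 (by positivity) b7 (by positivity) ?_ e4)
    refine (mul_le_mul_of_nonneg_left hq2 (by positivity)).trans_eq (by ring)
  · rw [hl]
    refine le_trans (loss_le hl0 b1 (by positivity) b5 (by positivity) ?_ (by positivity) b6) e3
    refine (mul_le_mul_of_nonneg_left hq1 (by positivity)).trans_eq (by ring)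

end Asymptotics

end ChungLu

end

/-! ### Assembly: constants independent of `n`, then `n` large. -/

theorem proposition5p2
    (wOut wIn : ∀ n : ℕ, Fin n → ℝ)
    (hOut_pos : ∀ n x, 0 < wOut n x) (hIn_pos : ∀ n x, 0 < wIn n x)
    (hsum : ∀ n, ∑ x, wOut n x = ∑ x, wIn n x)
    (M₀ M₁ M₂ η : ℝ) (hM₀ : 1 < M₀) (hM₁ : 1 < M₁) (hM₂ : 0 < M₂) (hη : η ∈ Set.Ioo (0 : ℝ) 1)
    (hOut : ∀ n x, M₀ ≤ wOut n x ∧ wOut n x ≤ M₁)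
    (hIn : ∀ n : ℕ, ∑ x, wIn n x ^ (2 + η) ≤ M₂ * n)
    (ε γ : ℝ) (hε : ε ∈ Set.Ioo (0 : ℝ) 1) (hγ : γ ∈ Set.Ioo (0 : ℝ) 1)
    (s : ℕ → ℕ)
    (hs : ∀ᶠ n : ℕ in atTop, (s n : ℝ) ≤ (1 - γ) * ChungLu.entropicTime (wOut n) (wIn n))
    -- `T n ω x` is the tree built from `x`, for an arbitrary way of breaking ties
    (T : ∀ n : ℕ, ChungLu.EdgeConfig n → Fin n → Set (Fin n × Fin n))
    (hT : ∀ (n : ℕ) (ω : ChungLu.EdgeConfig n) (x : Fin n),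
      ChungLu.IsGreedyTree (ChungLu.toDigraph ω) x (s n)
        (ChungLu.massThreshold (wOut n) (wIn n) γ (s n)) (T n ω x)) :
    ∀ δ : ℝ, 0 < δ →
      Tendsto
        (fun n : ℕ => ChungLu.graphLaw (wOut n) (wIn n)
          {ω | ∃ m : ℝ,
            IsLeast ((fun x => ChungLu.totalPathMass (ChungLu.toDigraph ω) (T n ω x) x (s n)) ''
              ChungLu.epsRoots (wOut n) (wIn n) ε ω) m ∧ |m - 1| ≤ δ})
        atTop (𝓝 1) := by
  intro δ hδ
  have hε0 := hε.1
  have hγ0 := hγ.1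
  obtain ⟨c, τ, hc0, hc1, hτ, hcτ⟩ := ChungLu.exists_outDegree_constants hM₀
  set C : ℝ := 2 * M₁ ^ 2 + 3 with hC
  set M : ℝ := 1 + M₂ with hM
  -- `D` covers the shifts `log c` and `log C` together with the additive error one of the entropy.
  set D : ℝ := 1 + |Real.log c| + |Real.log C| with hD
  have hlogc := neg_abs_le (Real.log c)
  have hlogC := le_abs_self (Real.log C)
  have hD1 : 1 ≤ D := by
    have := abs_nonneg (Real.log c)
    have := abs_nonneg (Real.log C)
    linarith
  have hcD : -(D - 1) ≤ Real.log c := by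
    have := abs_nonneg (Real.log C)
    linarith
  have hCD : Real.log C ≤ D - 1 := by
    have := abs_nonneg (Real.log c)
    linarith
  have hwb : ∀ n, ChungLu.WeightBounds (wOut n) (wIn n) M₀ M₁ M := fun n =>
    ⟨hM₀, fun x => (hOut n x).1, fun x => (hOut n x).2, hIn_pos n, hsum n,
      ChungLu.sum_sq_le hη.1 (hIn_pos n) (hIn n)⟩
  have hlog : Tendsto (fun n : ℕ => Real.log n) atTop atTop :=
    Real.tendsto_log_atTop.comp tendsto_natCast_atTop_atTop
  have hev : ∀ {f : ℝ → ℝ} {v u : ℝ}, Tendsto f atTop (𝓝 v) → v < u →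
      ∀ᶠ n : ℕ in atTop, f (Real.log n) ≤ u := fun hf hv =>
    hlog.eventually (hf.eventually_le_const hv)
  have e1 : ∀ᶠ n : ℕ in atTop, 40 * D / γ ≤ Real.log (Real.log n) :=
    (Real.tendsto_log_atTop.comp hlog).eventually_ge_atTop _
  have e2 : ∀ᶠ n : ℕ in atTop, Real.log (Real.log n) + D ≤ ε * Real.log n / 80 := by
    -- Half of `ε / 80` pays for `log log n`, half for `D`.
    have h1 := hlog.eventually ((Real.isLittleO_log_id_atTop.bound
      (show (0 : ℝ) < ε / 160 by positivity)))
    filter_upwards [h1, hlog.eventually_ge_atTop (160 * D / ε), hlog.eventually_ge_atTop 0]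
      with n h1 h2 h3
    rw [div_le_iff₀ hε0] at h2
    rw [id, Real.norm_eq_abs, Real.norm_eq_abs, abs_of_nonneg h3] at h1
    have := le_abs_self (Real.log (Real.log n))
    linarith
  have e3 : ∀ᶠ n : ℕ in atTop,
      4 * (M₁ * √(2 * M)) * (Real.log n ^ 2 * Real.exp (-(3 * γ / 16 * Real.log n))) +
        3 * (Real.log n ^ 2 * Real.exp (-(ε / 80 * Real.log n))) ≤ δ := by
    have h1 := ((ChungLu.tendsto_pow_mul_exp_neg 2
      (show 0 < 3 * γ / 16 by positivity)).const_mul (4 * (M₁ * √(2 * M)))).add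
        ((ChungLu.tendsto_pow_mul_exp_neg 2 (show 0 < ε / 80 by positivity)).const_mul 3)
    exact hev h1 (by simpa using hδ)
  have e4 : ∀ᶠ n : ℕ in atTop,
      2 * (M₁ * √(2 * M)) * (Real.log n ^ 1 * Real.exp (-(1 / 4 * Real.log n))) ≤ 1 :=
    hev ((ChungLu.tendsto_pow_mul_exp_neg 1
      (show (0 : ℝ) < 1 / 4 by norm_num)).const_mul (2 * (M₁ * √(2 * M)))) (by simp)
  have e5 : ∀ᶠ n : ℕ in atTop,
      M₁ * √M * (Real.log n ^ 1 * Real.exp (-(1 / 2 * Real.log n))) ≤ 1 :=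
    hev ((ChungLu.tendsto_pow_mul_exp_neg 1
      (show (0 : ℝ) < 1 / 2 by norm_num)).const_mul (M₁ * √M)) (by simp)
  have e6 : ∀ᶠ n : ℕ in atTop,
      √M * (Real.log n ^ 0 * Real.exp (-(1 / 2 * Real.log n))) ≤ M₀ - 1 :=
    hev ((ChungLu.tendsto_pow_mul_exp_neg 0
      (show (0 : ℝ) < 1 / 2 by norm_num)).const_mul (√M)) (by simpa using hM₀)
  have e7 : ∀ᶠ n : ℕ in atTop, 1 / c ≤ Real.log n := hlog.eventually_ge_atTop _
  have e8 : ∀ᶠ n : ℕ in atTop, 1 ≤ Real.log n := hlog.eventually_ge_atTop _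
  refine ChungLu.tendsto_measure_one_of_compl _ _
    ((ChungLu.tendsto_badRate hM₀).comp hlog) ?_
  filter_upwards [e1, e2, e3, e4, e5, e6, e7, e8, hs, eventually_gt_atTop 0]
    with n e1 e2 e3 e4 e5 e6 e7 e8 hs hn
  exact ChungLu.measureReal_compl_isLeast_le_badRate (hwb n) hM₁ (by linarith) hc0 hc1 hτ hcτ hC
    hD1 hcD hCD hε hγ hn rfl e1 e2 e3 e4 e5 e6 e7 e8 hs (T n) (hT n)
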